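/- **Setting.** Let $d\ge 1$, let $D\subset\mathbb R^d$ be a bounded open set (for example a bounded Lipschitz domain), let $V=H^1_0(D)$ with $\|v\|_V=\|\nabla v\|_{L^2(D)}$, and fix $f\in H^{-1}(D)=V'$ and a sequence $(\psi_j)_{j\ge1}$ in $L^\infty(D)$. Let $\gamma$ be the countable product of standard Gaussian measures on $U=\mathbb R^{\mathbb N}$. For $y\in U$ put $b(y)=\sum_{j\ge1}y_j\psi_j$ (convergence of the partial sums in $L^\infty(D)$), $a(y)=\exp(b(y))$, and let $u(y)\in V$ be the weak solution of $-\mathrm{div}(a(y)\nabla u(y))=f$, i.e. $\int_D a(y)\nabla u(y)\cdot\nabla v\,dx=f(v)$ for all $v\in V$. For $0\le k<\infty$, Property $M_k$ says that the series for $b(y)$ converges in $L^\infty(D)$ for $\gamma$-almost every $y$, that $y\mapsto b(y)$ is (Bochner) measurable from $U$ to $L^\infty(D)$, and that $\int_U \exp(k\|b(y)\|_{L^\infty(D)})\,d\gamma(y)<\infty$. Let $\mathcal F$ be the set of finitely supported sequences of nonnegative integers. For $\mu,\nu\in\mathcal F$ and a sequence $\rho=(\rho_j)_{j\ge1}$ of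 positive numbers put $\mu!=\prod_j\mu_j!$, $\binom{\nu}{\mu}=\prod_j\binom{\nu_j}{\mu_j}$ (with $\binom nm=0$ for $m>n$), $\rho^{2\mu}=\prod_j\rho_j^{2\mu_j}$, $\|\mu\|_\infty=\max_j\mu_j$ and $\partial^\mu=\prod_j\partial_{y_j}^{\mu_j}$, where the partial derivatives are limits of difference quotients in $V$. Let $H_n$ be the univariate Hermite polynomials, orthonormal for the standard Gaussian density, $H_\nu(y)=\prod_jH_{\nu_j}(y_j)$ and $u_\nu=\int_U u(y)H_\nu(y)\,d\gamma(y)\in V$. **Theorem 3.2.** Let $r\ge0$ be an integer and $\rho=(\rho_j)_{j\ge1}$ a sequence of positive numbers. Assume that Property $M_k$ holds for all $0\le k<\infty$. Then, for $\gamma$-almost every $y$, $u(y)$ exists, is unique, and has all iterated partial derivatives with values in $V$; $\partial^\mu u\in L^2(U,V,\gamma)$ for every $\mu\in\mathcal F$; the integrals $u_\nu$ converge; and $$\sum_{\mu\in\mathcal F,\ \|\mu\|_\infty\le r}\frac{\rho^{2\mu}}{\mu!}\int_U\|\partial^\mu u(y)\|_V^2\,d\gamma(y)=\sum_{\nu\in\mathcal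 F}b_\nu\|u_\nu\|_V^2$$ as an identity in $[0,\infty]$ (both sides may be infinite), where $$b_\nu:=\sum_{\mu\in\mathcal F,\ \|\mu\|_\infty\le r}\binom{\nu}{\mu}\rho^{2\mu}<\infty.$$ Moreover $$b_\nu=\prod_{j\ge1}\Bigl(\sum_{l=0}^r\binom{\nu_j}{l}\rho_j^{2l}\Bigr).$$ -/

import Mathlib

open MeasureTheory ProbabilityTheory Filter Topology
open scoped ENNReal ContDiff

/-! ### The Sobolev space `V = H¹₀(D)` -/

/-- Points of `ℝ^d`, with the Euclidean norm. -/
abbrev Pt (d : ℕ) : Type := EuclideanSpace ℝ (Fin d)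

/-- Lebesgue measure on `D`. -/
noncomputable abbrev vol {d : ℕ} (D : Set (Pt d)) : Measure (Pt d) := volume.restrict D

/-- The Hilbert space `L²(D) × L²(D; ℝ^d)`, in which `H¹(D)` sits through `v ↦ (v, ∇v)`. -/
abbrev GraphSpace {d : ℕ} (D : Set (Pt d)) : Type :=
  WithLp 2 (Lp ℝ 2 (vol D) × Lp (Pt d) 2 (vol D))

/-- The pairs `(φ, ∇φ)` with `φ ∈ C_c^∞(D)`. -/
noncomputable def testPairs {d : ℕ} (D : Set (Pt d)) : Submodule ℝ (GraphSpace D) where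
  carrier := {w | ∃ φ : Pt d → ℝ, ContDiff ℝ ∞ φ ∧ HasCompactSupport φ ∧ tsupport φ ⊆ D ∧
    w.fst =ᵐ[vol D] φ ∧ w.snd =ᵐ[vol D] gradient φ}
  zero_mem' := by
    refine ⟨0, contDiff_const, HasCompactSupport.zero, by simp, ?_, ?_⟩
    · exact Lp.coeFn_zero ℝ 2 (vol D)
    · filter_upwards [Lp.coeFn_zero (Pt d) 2 (vol D)] with x hx
      simpa [gradient] using hx
  add_mem' := by
    rintro w₁ w₂ ⟨φ₁, hs₁, hc₁, ht₁, hf₁, hg₁⟩ ⟨φ₂, hs₂, hc₂, ht₂, hf₂, hg₂⟩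
    refine ⟨φ₁ + φ₂, hs₁.add hs₂, hc₁.add hc₂,
      (tsupport_add φ₁ φ₂).trans (Set.union_subset ht₁ ht₂), ?_, ?_⟩
    · filter_upwards [Lp.coeFn_add w₁.fst w₂.fst, hf₁, hf₂] with x hx h₁ h₂
      simpa [h₁, h₂] using hx
    · filter_upwards [Lp.coeFn_add w₁.snd w₂.snd, hg₁, hg₂] with x hx h₁ h₂
      have d₁ : DifferentiableAt ℝ φ₁ x := (hs₁.differentiable (by simp)) x
      have d₂ : DifferentiableAt ℝ φ₂ x := (hs₂.differentiable (by simp)) x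
      have : gradient (φ₁ + φ₂) x = gradient φ₁ x + gradient φ₂ x := by
        simp [gradient, fderiv_add d₁ d₂]
      rw [this, ← h₁, ← h₂]
      simpa using hx
  smul_mem' := by
    rintro c w ⟨φ, hs, hc, ht, hf, hg⟩
    refine ⟨c • φ, hs.const_smul c, hc.smul_left (f := fun _ => c),
      (tsupport_smul_subset_right (fun _ => c) φ).trans ht, ?_, ?_⟩
    · filter_upwards [Lp.coeFn_smul c w.fst, hf] with x hx h₁
      simpa [h₁] using hx
    · filter_upwards [Lp.coeFn_smul c w.snd, hg] with x hx h₁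
      have d₁ : DifferentiableAt ℝ φ x := (hs.differentiable (by simp)) x
      have : gradient (c • φ) x = c • gradient φ x := by
        simp [gradient, fderiv_const_smul d₁ c]
      rw [this, ← h₁]
      simpa using hx

/-- `V = H¹₀(D)`: the closure of `C_c^∞(D)` in `H¹(D)`. Its elements are the pairs `(v, ∇v)`, and
the norm it inherits is the `H¹` norm, which on a bounded set is equivalent to `gradNorm` below (so
limits, derivatives and integrals in `V` are the same for both). -/
abbrev HOneZero {d : ℕ} (D : Set (Pt d)) : Type :=
  ↥((testPairs D).topologicalClosure)

/-- The gradient `∇v ∈ L²(D; ℝ^d)` of `v ∈ H¹₀(D)`. -/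
noncomputable def HOneZero.grad {d : ℕ} {D : Set (Pt d)} (v : HOneZero D) : Lp (Pt d) 2 (vol D) :=
  (v : GraphSpace D).snd

/-- The norm `‖v‖_V = ‖∇v‖_{L²(D)}`. -/
noncomputable def HOneZero.gradNorm {d : ℕ} {D : Set (Pt d)} (v : HOneZero D) : ℝ :=
  ‖v.grad‖

/-! ### The lognormal diffusion problem -/

/-- `v ∈ H¹₀(D)` is a weak solution of `-div(a ∇v) = f`, for `f ∈ H⁻¹(D)`. -/
def IsWeakSolution {d : ℕ} {D : Set (Pt d)} (a : Pt d → ℝ) (f : HOneZero D →L[ℝ] ℝ)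
    (v : HOneZero D) : Prop :=
  ∀ w : HOneZero D, ∫ x in D, a x * inner ℝ (v.grad x) (w.grad x) = f w

/-- The standard Gaussian product measure `γ` on `U = ℝ^ℕ`. -/
noncomputable def gammaU : Measure (ℕ → ℝ) := Measure.infinitePi fun _ => gaussianReal 0 1

/-- `B ∈ L^∞(D)` is the sum of the series `∑ y_j ψ_j`, convergent in `L^∞(D)`. -/
def IsFieldSum {d : ℕ} {D : Set (Pt d)} (ψ : ℕ → Lp ℝ ∞ (vol D)) (y : ℕ → ℝ)
    (B : Lp ℝ ∞ (vol D)) : Prop :=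
  Tendsto (fun J : ℕ => ∑ j ∈ Finset.range J, y j • ψ j) atTop (𝓝 B)

open Classical in
/-- `b(y) = ∑ y_j ψ_j` (and `0` at those `y` for which the series diverges). -/
noncomputable def field {d : ℕ} {D : Set (Pt d)} (ψ : ℕ → Lp ℝ ∞ (vol D)) (y : ℕ → ℝ) :
    Lp ℝ ∞ (vol D) :=
  if h : ∃ B, IsFieldSum ψ y B then h.choose else 0

/-- The diffusion coefficient `a(y) = exp(b(y))`. -/
noncomputable def coeff {d : ℕ} {D : Set (Pt d)} (ψ : ℕ → Lp ℝ ∞ (vol D)) (y : ℕ → ℝ) :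
    Pt d → ℝ :=
  fun x => Real.exp (field ψ y x)

open Classical in
/-- The solution map: `u(y) ∈ V` is the weak solution of `-div(a(y) ∇u(y)) = f`. -/
noncomputable def solution {d : ℕ} {D : Set (Pt d)} (ψ : ℕ → Lp ℝ ∞ (vol D))
    (f : HOneZero D →L[ℝ] ℝ) (y : ℕ → ℝ) : HOneZero D :=
  if h : ∃ v, IsWeakSolution (coeff ψ y) f v then h.choose else 0

/-- Property `M_k`: the series defining `b(y)` converges in `L^∞(D)` almost surely, `y ↦ b(y)` is
(Bochner) measurable with values in `L^∞(D)`, and `exp(k ‖b(y)‖_{L^∞})` has finite expectation. -/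
def PropertyM {d : ℕ} {D : Set (Pt d)} (ψ : ℕ → Lp ℝ ∞ (vol D)) (k : ℝ) : Prop :=
  (∀ᵐ y ∂gammaU, ∃ B, IsFieldSum ψ y B) ∧
  AEStronglyMeasurable (field ψ) gammaU ∧
  Integrable (fun y => Real.exp (k * ‖field ψ y‖)) gammaU

/-! ### Partial derivatives in the parameter -/

/-- `∂_{y_j} w`: the limit in the target space of `(w (y + h e_j) - w y) / h` as `h → 0`. -/
noncomputable def partialDeriv {V : Type*} [NormedAddCommGroup V] [NormedSpace ℝ V] (j : ℕ)
    (w : (ℕ → ℝ) → V) : (ℕ → ℝ) → V :=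
  fun y => lineDeriv ℝ w y (Pi.single j 1)

/-- `∂_{y_{j₁}} ⋯ ∂_{y_{jₙ}} w` for a list `[j₁, …, jₙ]`. -/
noncomputable def listDeriv {V : Type*} [NormedAddCommGroup V] [NormedSpace ℝ V] (l : List ℕ)
    (w : (ℕ → ℝ) → V) : (ℕ → ℝ) → V :=
  l.foldr partialDeriv w

/-- `∂^μ w = ∂_{y_0}^{μ_0} ∂_{y_1}^{μ_1} ⋯ w` for a finitely supported multi-index `μ`: the list
holds each `j` exactly `μ_j` times, in increasing order. -/
noncomputable def multiDeriv {V : Type*} [NormedAddCommGroup V] [NormedSpace ℝ V] (μ : ℕ →₀ ℕ)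
    (w : (ℕ → ℝ) → V) : (ℕ → ℝ) → V :=
  listDeriv ((Finsupp.toMultiset μ).sort (· ≤ ·)) w

/-! ### Multi-indices, Hermite polynomials and coefficients -/

/-- `μ! = ∏_j μ_j!`. -/
def multiFactorial (μ : ℕ →₀ ℕ) : ℕ := μ.prod fun _ m => m.factorial

/-- `C(ν, μ) = ∏_j C(ν_j, μ_j)`; the factors outside the support of `μ` are `1`. -/
def multiChoose (ν μ : ℕ →₀ ℕ) : ℕ := μ.prod fun j m => (ν j).choose m

/-- `ρ^{2μ} = ∏_j ρ_j^{2 μ_j}`. -/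
noncomputable def rhoPow (ρ : ℕ → ℝ) (μ : ℕ →₀ ℕ) : ℝ := μ.prod fun j m => ρ j ^ (2 * m)

/-- The finitely supported multi-indices with `‖μ‖_{ℓ^∞} ≤ r`. -/
abbrev BoundedIndex (r : ℕ) : Type := {μ : ℕ →₀ ℕ // ∀ j, μ j ≤ r}

/-- The Hermite polynomial `H_n`, normalized in `L²` of the standard Gaussian density:
the probabilists' polynomial divided by `√(n!)`. -/
noncomputable def hermiteFun (n : ℕ) (t : ℝ) : ℝ :=
  Polynomial.aeval t (Polynomial.hermite n) / √(n.factorial : ℝ)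

/-- `H_ν(y) = ∏_j H_{ν_j}(y_j)`; the factors outside the support of `ν` are `H_0 = 1`. -/
noncomputable def multiHermite (ν : ℕ →₀ ℕ) (y : ℕ → ℝ) : ℝ :=
  ν.prod fun j n => hermiteFun n (y j)

/-- The Hermite coefficient `u_ν = ∫_U u(y) H_ν(y) dγ(y)`. -/
noncomputable def hermiteCoeff {V : Type*} [NormedAddCommGroup V] [NormedSpace ℝ V]
    (u : (ℕ → ℝ) → V) (ν : ℕ →₀ ℕ) : V :=
  ∫ y, multiHermite ν y • u y ∂gammaU

/-- The weight `b_ν = ∑_{‖μ‖_∞ ≤ r} C(ν, μ) ρ^{2μ}`. -/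
noncomputable def hermiteWeight (r : ℕ) (ρ : ℕ → ℝ) (ν : ℕ →₀ ℕ) : ℝ :=
  ∑' μ : BoundedIndex r, (multiChoose ν μ : ℝ) * rhoPow ρ μ

/-! ### The Gaussian product measure -/

/-! Write `G` for the gradient on `V`. By Riesz, the weak equation with field `B` reads `G† exp(B) G
u = f`. The Poincaré inequality makes this operator coercive, so `u` is the inverse applied to `f`:
a function of `B` alone (`isWeakSolution_iff`). Moving `y_j` by `t` moves `B` by `t ψ_j`, and this
preserves convergence of the series. Hence the parameter derivatives are directional derivatives in
`B`. They stay in a class of functions built from the inverse, `exp(B)` and fixed multipliers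
(`SolutionClass.exists_hasDerivAt`). Every member of the class is continuous and at most `C
exp(k‖B‖)` (`SolutionClass.exists_norm_le`), so the exponential moments put every derivative in
`L²(γ)`.

Gaussian integration by parts together with the three-term recurrence turns a derivative into an
index shift, `(∂_j w)_ν = √(ν_j + 1) w_{ν + e_j}` (`hermiteCoeff_deriv`). Iterating gives `√(ν!)
(∂^μ u)_ν = √((ν+μ)!) u_{ν+μ}` (`sqrt_smul_hermiteCoeff_listDeriv`).

Parseval for the gradient of `∂^μ u` (`lintegral_gradNorm_sq`) expresses its energy as the sum over
`ν` of `(ν+μ)!/ν! ‖u_{ν+μ}‖²`. After multiplication by `ρ^{2μ}/μ!` the factorials form `C(ν+μ, μ)`.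
All terms are nonnegative, so the sums over `μ` and `ν` can be exchanged in `[0, ∞]`, and collecting
the weight of each `u_ν` yields `b_ν` (`tsum_tsum_multiChoose`).

Parseval itself rests on completeness of the Hermite system, which is obtained from uniqueness of
characteristic functions on `ℝ^ℕ` (`ae_eq_zero_of_hermiteCoeff_eq_zero`). -/

instance isProbabilityMeasure_gammaU : IsProbabilityMeasure gammaU := by
  unfold gammaU; infer_instance

/-- Resampling one coordinate preserves `γ`. -/
theorem measurePreserving_update (j : ℕ) :
    MeasurePreserving (fun p : ℝ × (ℕ → ℝ) => Function.update p.2 j p.1)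
      ((gaussianReal 0 1).prod gammaU) gammaU := by
  have hm : Measurable (fun p : ℝ × (ℕ → ℝ) => Function.update p.2 j p.1) := by
    rw [measurable_pi_iff]
    intro i
    by_cases h : i = j
    · subst h; simpa using measurable_fst
    · simp only [Function.update_of_ne h]; fun_prop
  refine ⟨hm, Measure.eq_infinitePi _ fun s t ht => ?_⟩
  rw [Measure.map_apply hm (MeasurableSet.pi s.countable_toSet fun i _ => ht i)]
  by_cases hj : j ∈ s
  · have : (fun p : ℝ × (ℕ → ℝ) => Function.update p.2 j p.1) ⁻¹' (Set.pi s t)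
        = t j ×ˢ Set.pi (s.erase j : Finset ℕ) t := by
      ext p
      simp only [Set.mem_preimage, Set.mem_pi, Set.mem_prod, Finset.mem_coe, Finset.mem_erase]
      refine ⟨fun h => ⟨by simpa using h j hj, fun i hi => by simpa [hi.1] using h i hi.2⟩,
        fun h i hi => ?_⟩
      by_cases hij : i = j
      · subst hij; simpa using h.1
      · simpa [hij] using h.2 i ⟨hij, hi⟩
    rw [this, Measure.prod_prod, gammaU, Measure.infinitePi_pi _ (fun i _ => ht i),
      Finset.mul_prod_erase s (fun i => gaussianReal 0 1 (t i)) hj]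
  · have : (fun p : ℝ × (ℕ → ℝ) => Function.update p.2 j p.1) ⁻¹' (Set.pi s t)
        = Set.univ ×ˢ Set.pi s t := by
      ext p
      simp only [Set.mem_preimage, Set.mem_pi, Set.mem_prod, Finset.mem_coe, Set.mem_univ,
        true_and]
      refine forall₂_congr fun i hi => ?_
      have hij : i ≠ j := fun h => hj (h ▸ hi)
      simp [hij]
    rw [this, Measure.prod_prod, gammaU, Measure.infinitePi_pi _ (fun i _ => ht i)]
    simp

/-! ### Stein's identity and integration by parts in one coordinate. -/

section IntegrationByParts

variable {E : Type*} [NormedAddCommGroup E] [NormedSpace ℝ E]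

theorem integrable_gaussianReal_iff {f : ℝ → E} :
    Integrable f (gaussianReal 0 1) ↔ Integrable (fun t => gaussianPDFReal 0 1 t • f t) := by
  rw [gaussianReal_of_var_ne_zero 0 one_ne_zero, integrable_withDensity_iff_integrable_smul'
    (measurable_gaussianPDF 0 1) (ae_of_all _ fun _ => gaussianPDF_lt_top)]
  simp [toReal_gaussianPDF]

theorem hasDerivAt_gaussianPDFReal (t : ℝ) :
    HasDerivAt (gaussianPDFReal 0 1) (-t * gaussianPDFReal 0 1 t) t := by
  have h : HasDerivAt (fun t : ℝ => (√(2 * Real.pi * (1 : NNReal)))⁻¹ *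
      Real.exp (-(t - 0) ^ 2 / (2 * (1 : NNReal))))
      ((√(2 * Real.pi * (1 : NNReal)))⁻¹ * (Real.exp (-(t - 0) ^ 2 / (2 * (1 : NNReal))) *
        (-(2 * (t - 0)) / (2 * (1 : NNReal))))) t := by
    refine HasDerivAt.const_mul _ (HasDerivAt.exp (HasDerivAt.div_const (HasDerivAt.neg ?_) _))
    simpa using! ((hasDerivAt_id t).sub_const 0).pow 2
  have e : gaussianPDFReal 0 1 = fun t : ℝ => (√(2 * Real.pi * (1 : NNReal)))⁻¹ *
      Real.exp (-(t - 0) ^ 2 / (2 * (1 : NNReal))) := by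
    ext t; simp [gaussianPDFReal]
  rw [e]
  convert h using 1
  simp only [NNReal.coe_one]
  ring

/-- Stein's identity on the line. -/
theorem integral_deriv_gaussianReal {φ φ' : ℝ → E} (hd : ∀ t, HasDerivAt φ (φ' t) t)
    (h0 : Integrable φ (gaussianReal 0 1)) (h1 : Integrable φ' (gaussianReal 0 1))
    (h2 : Integrable (fun t => t • φ t) (gaussianReal 0 1)) :
    ∫ t, φ' t ∂gaussianReal 0 1 = ∫ t, t • φ t ∂gaussianReal 0 1 := by
  have key := integral_eq_zero_of_hasDerivAt_of_integrable
    (f := fun t => gaussianPDFReal 0 1 t • φ t)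
    (f' := fun t => gaussianPDFReal 0 1 t • (φ' t - t • φ t))
    (fun t => by
      convert! (hasDerivAt_gaussianPDFReal t).smul (hd t) using 1
      module)
    (integrable_gaussianReal_iff.1 (h1.sub h2)) (integrable_gaussianReal_iff.1 h0)
  rw [← integral_gaussianReal_eq_integral_smul (one_ne_zero), integral_sub h1 h2] at key
  exact sub_eq_zero.1 key

/-- Fubini for the resampled coordinate. The inner integral is one-dimensional, which is where
Stein's identity applies. -/
theorem integral_gammaU_update {F : (ℕ → ℝ) → E} (j : ℕ) (hF : Integrable F gammaU) :
    ∫ y, F y ∂gammaU = ∫ y, ∫ t, F (Function.update y j t) ∂gaussianReal 0 1 ∂gammaU := by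
  have mp := measurePreserving_update j
  have hi : Integrable (fun p : ℝ × (ℕ → ℝ) => F (Function.update p.2 j p.1))
      ((gaussianReal 0 1).prod gammaU) := mp.integrable_comp_of_integrable hF
  have hmap := integral_map mp.measurable.aemeasurable (f := F)
    (by rw [mp.map_eq]; exact hF.aestronglyMeasurable)
  rw [mp.map_eq] at hmap
  rw [← integral_prod_symm _ hi, hmap]

omit [NormedSpace ℝ E] in
theorem ae_integrable_update {F : (ℕ → ℝ) → E} (j : ℕ) (hF : Integrable F gammaU) :
    ∀ᵐ y ∂gammaU, Integrable (fun t => F (Function.update y j t)) (gaussianReal 0 1) :=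
  ((measurePreserving_update j).integrable_comp_of_integrable hF).prod_left_ae

/-- Gaussian integration by parts in one coordinate of `U`. -/
theorem integral_deriv_gammaU {w w' : (ℕ → ℝ) → E} (j : ℕ)
    (hd : ∀ᵐ y ∂gammaU, ∀ t, HasDerivAt (fun s => w (Function.update y j s))
      (w' (Function.update y j t)) t)
    (h0 : Integrable w gammaU) (h1 : Integrable w' gammaU)
    (h2 : Integrable (fun y => y j • w y) gammaU) :
    ∫ y, w' y ∂gammaU = ∫ y, y j • w y ∂gammaU := by
  rw [integral_gammaU_update j h1, integral_gammaU_update j h2]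
  refine integral_congr_ae ?_
  filter_upwards [hd, ae_integrable_update j h0, ae_integrable_update j h1,
    ae_integrable_update j h2] with y hy g0 g1 g2
  simp only [Function.update_self] at g2 ⊢
  exact integral_deriv_gaussianReal hy g0 g1 g2

end IntegrationByParts

/-! ### Functions with all moments -/

/-- The algebra of functions on `U` that lie in all `L^p(γ)`, `p < ⊤`. -/
def momentAlgebra : Subalgebra ℝ ((ℕ → ℝ) → ℝ) where
  carrier := {f | ∀ p : ℝ≥0∞, p ≠ ⊤ → MemLp f p gammaU}
  mul_mem' := by
    intro f g hf hg p hp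
    -- Hölder with both factors in `L^{2p}`.
    have h2 : p * 2 ≠ ⊤ := ENNReal.mul_ne_top hp (by simp)
    have : ENNReal.HolderTriple (p * 2) (p * 2) p := ⟨by
      rw [ENNReal.mul_inv (by simp) (by simp), ← mul_add, ENNReal.inv_two_add_inv_two, mul_one]⟩
    exact (hg _ h2).mul (hf _ h2)
  add_mem' := fun hf hg p hp => (hf p hp).add (hg p hp)
  algebraMap_mem' := fun c p _ => memLp_const c

theorem coord_mem_momentAlgebra (j : ℕ) : (fun y : ℕ → ℝ => y j) ∈ momentAlgebra := fun p hp =>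
  (memLp_id_gaussianReal' p hp).comp_measurePreserving
    (measurePreserving_eval_infinitePi (fun _ => gaussianReal 0 1) j)

theorem exp_coord_mem_momentAlgebra (c : ℝ) (j : ℕ) :
    (fun y : ℕ → ℝ => Real.exp (c * y j)) ∈ momentAlgebra := by
  intro p hp
  have h : MemLp (fun t => Real.exp (c * t)) p (gaussianReal 0 1) := by
    by_cases hp0 : p = 0
    · subst hp0
      exact memLp_zero_iff_aestronglyMeasurable.2 (by fun_prop)
    rw [← integrable_norm_rpow_iff (by fun_prop) hp0 hp]
    refine (integrable_exp_mul_gaussianReal (p.toReal * c)).congr (ae_of_all _ fun t => ?_)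
    simp only [Real.norm_eq_abs, Real.abs_exp]
    rw [← Real.exp_mul]; ring_nf
  exact h.comp_measurePreserving
    (measurePreserving_eval_infinitePi (fun _ => gaussianReal 0 1) j)

/-! ### Hermite polynomials -/

theorem derivative_hermite_succ (n : ℕ) :
    Polynomial.derivative (Polynomial.hermite (n + 1)) =
      ((n : Polynomial ℤ) + 1) * Polynomial.hermite n := by
  induction n with
  | zero => simp
  | succ n ih =>
    rw [Polynomial.hermite_succ (n + 1), Polynomial.derivative_sub, ih]
    simp only [Polynomial.derivative_mul, Polynomial.derivative_X, Polynomial.derivative_add,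
      Polynomial.derivative_natCast, Polynomial.derivative_one, ih]
    have h := Polynomial.hermite_succ n
    push_cast
    linear_combination (-(n : Polynomial ℤ) - 1) * h

theorem hermiteFun_zero (t : ℝ) : hermiteFun 0 t = 1 := by simp [hermiteFun]

theorem sqrt_factorial_succ (n : ℕ) :
    √((n + 1).factorial : ℝ) = √((n : ℝ) + 1) * √(n.factorial : ℝ) := by
  rw [Nat.factorial_succ, Nat.cast_mul, Real.sqrt_mul (by positivity)]
  push_cast; rfl

theorem sqrt_factorial_pos (n : ℕ) : 0 < √(n.factorial : ℝ) :=
  Real.sqrt_pos.2 (by exact_mod_cast n.factorial_pos)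

/-- At `n = 0` the truncated index `n - 1` is harmless because its factor `√0` vanishes; the same
convention serves in the formulas below. -/
theorem hasDerivAt_hermiteFun (n : ℕ) (t : ℝ) :
    HasDerivAt (hermiteFun n) (√(n : ℝ) * hermiteFun (n - 1) t) t := by
  have h := ((Polynomial.hermite n).hasDerivAt_aeval t).div_const (√(n.factorial : ℝ))
  refine h.congr_deriv ?_
  cases n with
  | zero => simp
  | succ n =>
    rw [derivative_hermite_succ, sqrt_factorial_succ]
    have h1 : (0 : ℝ) < √((n : ℝ) + 1) := Real.sqrt_pos.2 (by positivity)
    have h2 := sqrt_factorial_pos n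
    have h3 : √((n : ℝ) + 1) * √((n : ℝ) + 1) = n + 1 := Real.mul_self_sqrt (by positivity)
    simp only [hermiteFun, Nat.add_sub_cancel, map_mul, map_add, map_natCast, map_one]
    push_cast
    field_simp
    linear_combination -(Polynomial.aeval t (Polynomial.hermite n)) * h3

theorem hermiteFun_succ (n : ℕ) (t : ℝ) :
    √((n : ℝ) + 1) * hermiteFun (n + 1) t =
      t * hermiteFun n t - √(n : ℝ) * hermiteFun (n - 1) t := by
  have h1 : (0 : ℝ) < √((n : ℝ) + 1) := Real.sqrt_pos.2 (by positivity)
  have h2 := sqrt_factorial_pos n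
  have e : √((n : ℝ) + 1) * hermiteFun (n + 1) t =
      Polynomial.aeval t (Polynomial.hermite (n + 1)) / √(n.factorial : ℝ) := by
    rw [hermiteFun, sqrt_factorial_succ]; field_simp
  have hd := (hasDerivAt_hermiteFun n t).unique
    (((Polynomial.hermite n).hasDerivAt_aeval t).div_const (√(n.factorial : ℝ)))
  rw [e, hd, Polynomial.hermite_succ, hermiteFun]
  simp only [map_sub, map_mul, Polynomial.aeval_X]
  ring

theorem multiHermite_zero (y : ℕ → ℝ) : multiHermite 0 y = 1 := by simp [multiHermite]

theorem multiHermite_eq_mul_erase (ν : ℕ →₀ ℕ) (j : ℕ) (y : ℕ → ℝ) :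
    multiHermite ν y = hermiteFun (ν j) (y j) * multiHermite (ν.erase j) y :=
  (Finsupp.mul_prod_erase' ν j (fun j n => hermiteFun n (y j)) fun _ => hermiteFun_zero _).symm

/-- Isolates the dependence on one variable, so that the univariate formulas lift to multi-indices.
-/
theorem multiHermite_update (ν : ℕ →₀ ℕ) (j : ℕ) (y : ℕ → ℝ) (t : ℝ) :
    multiHermite ν (Function.update y j t) =
      hermiteFun (ν j) t * multiHermite (ν.erase j) y := by
  rw [multiHermite_eq_mul_erase ν j, Function.update_self]
  congr 1
  refine Finsupp.prod_congr fun i hi => ?_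
  have hij : i ≠ j := by
    rintro rfl; simp at hi
  rw [Function.update_of_ne hij]

theorem erase_add_single (ν : ℕ →₀ ℕ) (j n : ℕ) :
    (ν + Finsupp.single j n).erase j = ν.erase j := by
  ext i
  by_cases h : i = j
  · subst h; simp
  · simp [Finsupp.erase_ne h]

theorem erase_sub_single (ν : ℕ →₀ ℕ) (j n : ℕ) :
    (ν - Finsupp.single j n).erase j = ν.erase j := by
  ext i
  by_cases h : i = j
  · subst h; simp
  · simp [Finsupp.erase_ne h, Finsupp.single_eq_of_ne h]

theorem hasDerivAt_multiHermite_update (ν : ℕ →₀ ℕ) (j : ℕ) (y : ℕ → ℝ) (t : ℝ) :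
    HasDerivAt (fun s => multiHermite ν (Function.update y j s))
      (√(ν j : ℝ) * multiHermite (ν - Finsupp.single j 1) (Function.update y j t)) t := by
  simp only [multiHermite_update, erase_sub_single]
  convert! (hasDerivAt_hermiteFun (ν j) t).mul_const (multiHermite (ν.erase j) y) using 1
  simp [mul_assoc]

theorem multiHermite_add_single (ν : ℕ →₀ ℕ) (j : ℕ) (y : ℕ → ℝ) :
    √((ν j : ℝ) + 1) * multiHermite (ν + Finsupp.single j 1) y =
      y j * multiHermite ν y - √(ν j : ℝ) * multiHermite (ν - Finsupp.single j 1) y := by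
  rw [multiHermite_eq_mul_erase (ν + Finsupp.single j 1) j, multiHermite_eq_mul_erase ν j,
    multiHermite_eq_mul_erase (ν - Finsupp.single j 1) j, erase_add_single, erase_sub_single]
  have := hermiteFun_succ (ν j) (y j)
  simp only [Finsupp.add_apply, Finsupp.single_eq_same, Finsupp.tsub_apply]
  linear_combination (multiHermite (ν.erase j) y) * this

theorem multiHermite_mem_momentAlgebra (ν : ℕ →₀ ℕ) : multiHermite ν ∈ momentAlgebra := by
  have h1 (j n : ℕ) : (fun y : ℕ → ℝ => hermiteFun n (y j)) ∈ momentAlgebra := by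
    have e : (fun y : ℕ → ℝ => hermiteFun n (y j)) = (√(n.factorial : ℝ))⁻¹ •
        ∑ i ∈ Finset.range ((Polynomial.hermite n).natDegree + 1),
          ((Polynomial.hermite n).coeff i : ℝ) • (fun y : ℕ → ℝ => y j) ^ i := by
      ext y
      simp [hermiteFun, Polynomial.aeval_eq_sum_range, div_eq_inv_mul]
    rw [e]
    exact Subalgebra.smul_mem _ (Subalgebra.sum_mem _ fun i _ => Subalgebra.smul_mem _
      (Subalgebra.pow_mem _ (coord_mem_momentAlgebra j) i) _) _
  have h2 : multiHermite ν = ν.prod fun j n => fun y : ℕ → ℝ => hermiteFun n (y j) := by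
    ext y; simp [multiHermite, Finsupp.prod]
  rw [h2]
  exact Subalgebra.prod_mem _ fun j _ => h1 j _

theorem memLp_multiHermite (ν : ℕ →₀ ℕ) {p : ℝ≥0∞} (hp : p ≠ ⊤) :
    MemLp (multiHermite ν) p gammaU := multiHermite_mem_momentAlgebra ν p hp

/-! ### Hermite coefficients and derivatives -/

section Shift

variable {E : Type*} [NormedAddCommGroup E] [NormedSpace ℝ E]

theorem integrable_smul_of_mem_momentAlgebra {g : (ℕ → ℝ) → ℝ} (hg : g ∈ momentAlgebra)
    {w : (ℕ → ℝ) → E} (hw : MemLp w 2 gammaU) : Integrable (fun y => g y • w y) gammaU :=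
  memLp_one_iff_integrable.1 (hw.smul (hg 2 (by simp)))

theorem integrable_multiHermite_smul (ν : ℕ →₀ ℕ) {w : (ℕ → ℝ) → E} (hw : MemLp w 2 gammaU) :
    Integrable (fun y => multiHermite ν y • w y) gammaU :=
  integrable_smul_of_mem_momentAlgebra (multiHermite_mem_momentAlgebra ν) hw

/-- The Hermite coefficients of a partial derivative. -/
theorem hermiteCoeff_deriv {w w' : (ℕ → ℝ) → E} (j : ℕ)
    (hd : ∀ᵐ y ∂gammaU, ∀ t, HasDerivAt (fun s => w (Function.update y j s))
      (w' (Function.update y j t)) t)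
    (hw : MemLp w 2 gammaU) (hw' : MemLp w' 2 gammaU) (ν : ℕ →₀ ℕ) :
    hermiteCoeff w' ν = √((ν j : ℝ) + 1) • hermiteCoeff w (ν + Finsupp.single j 1) := by
  have i1 := integrable_multiHermite_smul ν hw'
  have i2 := (integrable_multiHermite_smul (ν - Finsupp.single j 1) hw).fun_smul (√(ν j : ℝ))
  have i3 : Integrable (fun y => y j • multiHermite ν y • w y) gammaU := by
    have := integrable_smul_of_mem_momentAlgebra (mul_mem (coord_mem_momentAlgebra j)
      (multiHermite_mem_momentAlgebra ν)) hw
    simpa [mul_smul] using this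
  -- Integrate by parts in the product `H_ν w`. The term from differentiating `H_ν`, moved to the
  -- other side, combines with `y_j H_ν` to give `√(ν_j + 1) H_{ν + e_j}`.
  have key := integral_deriv_gammaU (w := fun y => multiHermite ν y • w y)
    (w' := fun y => multiHermite ν y • w' y +
      √(ν j : ℝ) • multiHermite (ν - Finsupp.single j 1) y • w y) j
    (by
      filter_upwards [hd] with y hy t
      convert! (hasDerivAt_multiHermite_update ν j y t).smul (hy t) using 1
      rw [smul_smul])
    (integrable_multiHermite_smul ν hw) (i1.add i2) i3
  rw [integral_add i1 i2] at key
  rw [hermiteCoeff, hermiteCoeff, ← integral_smul, eq_sub_of_add_eq key, ← integral_sub i3 i2]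
  congr 1 with y
  simp only [smul_smul, ← sub_smul, multiHermite_add_single]

end Shift

/-! ### Orthonormality -/

theorem multiIndex_induction {P : (ℕ →₀ ℕ) → Prop} (h0 : P 0)
    (h1 : ∀ ν j, P ν → P (ν + Finsupp.single j 1)) (ν : ℕ →₀ ℕ) : P ν := by
  have h (s : Multiset ℕ) : P (Multiset.toFinsupp s) := by
    induction s using Multiset.induction with
    | empty => simpa using h0
    | cons j s ih =>
      rw [← Multiset.singleton_add, add_comm, Multiset.toFinsupp_add,
        Multiset.toFinsupp_singleton]
      exact h1 _ _ ih
  simpa using h (Finsupp.toMultiset ν)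

/-- The shift rule applied to a Hermite polynomial lowers both indices at once, and this drives the
induction for orthonormality. -/
theorem hermiteCoeff_multiHermite_add_single (ν μ : ℕ →₀ ℕ) (j : ℕ) :
    √((ν j : ℝ) + 1) * hermiteCoeff (multiHermite μ) (ν + Finsupp.single j 1) =
      √(μ j : ℝ) * hermiteCoeff (multiHermite (μ - Finsupp.single j 1)) ν := by
  have h := hermiteCoeff_deriv (w := multiHermite μ)
    (w' := fun y => √(μ j : ℝ) * multiHermite (μ - Finsupp.single j 1) y) j
    (ae_of_all _ fun y t => hasDerivAt_multiHermite_update μ j y t)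
    (memLp_multiHermite μ (by simp)) ((memLp_multiHermite _ (by simp)).const_mul _) ν
  rw [smul_eq_mul] at h
  rw [← h, hermiteCoeff, hermiteCoeff, ← integral_const_mul]
  congr 1 with y
  simp only [smul_eq_mul]; ring

theorem hermiteCoeff_multiHermite (ν μ : ℕ →₀ ℕ) :
    hermiteCoeff (multiHermite μ) ν = if ν = μ then 1 else 0 := by
  induction ν using multiIndex_induction generalizing μ with
  | h0 =>
    induction μ using multiIndex_induction with
    | h0 => simp [hermiteCoeff, multiHermite_zero]
    | h1 μ j _ =>
      have h := hermiteCoeff_multiHermite_add_single μ 0 j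
      -- By symmetry the nonzero index moves to the other slot, where lowering it differentiates the
      -- constant `H_0` and gives zero.
      have e : hermiteCoeff (multiHermite (μ + Finsupp.single j 1)) 0 =
          hermiteCoeff (multiHermite 0) (μ + Finsupp.single j 1) := by
        simp [hermiteCoeff, mul_comm]
      have hne : (0 : ℕ →₀ ℕ) ≠ μ + Finsupp.single j 1 := by
        intro h; have := DFunLike.congr_fun h j; simp at this
      have hp : √((μ j : ℝ) + 1) ≠ 0 := (Real.sqrt_pos.2 (by positivity)).ne'
      rw [e, if_neg hne]
      simpa [hp] using h
  | h1 ν j ih =>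
    have hp : √((ν j : ℝ) + 1) ≠ 0 := (Real.sqrt_pos.2 (by positivity)).ne'
    refine mul_left_cancel₀ hp ?_
    rw [hermiteCoeff_multiHermite_add_single, ih]
    by_cases hμ : μ j = 0
    · have hne : ν + Finsupp.single j 1 ≠ μ := by
        rintro rfl; simp at hμ
      simp [hμ, hne]
    · obtain ⟨μ, rfl⟩ : ∃ μ', μ = μ' + Finsupp.single j 1 :=
        ⟨μ - Finsupp.single j 1, by
          ext i
          by_cases h : i = j
          · subst h; simp; omega
          · simp [Finsupp.single_eq_of_ne h]⟩
      simp only [add_tsub_cancel_right, add_left_inj]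
      split_ifs with h
      · subst h; simp
      · simp

/-! ### Completeness of the Hermite system -/

/-- The linear form `y ↦ ∑ L_j y_j`. -/
noncomputable def coordForm (L : ℕ →₀ ℝ) (y : ℕ → ℝ) : ℝ := L.sum fun j c => c * y j

theorem measurable_coordForm (L : ℕ →₀ ℝ) : Measurable (coordForm L) := by
  unfold coordForm Finsupp.sum; fun_prop

theorem exp_coordForm_mem_momentAlgebra (L : ℕ →₀ ℝ) :
    (fun y => Real.exp (coordForm L y)) ∈ momentAlgebra := by
  have : (fun y => Real.exp (coordForm L y)) =
      ∏ j ∈ L.support, fun y : ℕ → ℝ => Real.exp (L j * y j) := by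
    ext y; simp [coordForm, Finsupp.sum, Real.exp_sum]
  rw [this]
  exact Subalgebra.prod_mem _ fun j _ => exp_coord_mem_momentAlgebra _ j

/-- Follows from `exp |x| ≤ exp x + exp (-x)`; it supplies the dominating function for the power
series of `exp (i L)`. -/
theorem exp_abs_coordForm_mem_momentAlgebra (L : ℕ →₀ ℝ) :
    (fun y => Real.exp |coordForm L y|) ∈ momentAlgebra := by
  intro p hp
  have h := add_mem (exp_coordForm_mem_momentAlgebra L) (exp_coordForm_mem_momentAlgebra (-L)) p hp
  refine h.mono ((measurable_coordForm L).abs.exp.aestronglyMeasurable) (ae_of_all _ fun y => ?_)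
  have hneg : coordForm (-L) y = -coordForm L y := by
    simp [coordForm, Finsupp.sum]
  simp only [Pi.add_apply, hneg, Real.norm_eq_abs, Real.abs_exp]
  exact (Real.exp_abs_le _).trans (le_abs_self _)

/-- The three-term recurrence solved for `y_j H_ν`. -/
theorem coord_mul_mem_span {h : (ℕ → ℝ) → ℝ} (j : ℕ)
    (hh : h ∈ Submodule.span ℝ (Set.range multiHermite)) :
    (fun y => y j * h y) ∈ Submodule.span ℝ (Set.range multiHermite) := by
  induction hh using Submodule.span_induction with
  | mem x hx =>
    obtain ⟨ν, rfl⟩ := hx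
    have : (fun y => y j * multiHermite ν y) =
        √((ν j : ℝ) + 1) • multiHermite (ν + Finsupp.single j 1) +
          √(ν j : ℝ) • multiHermite (ν - Finsupp.single j 1) := by
      ext y
      simp [multiHermite_add_single]
    rw [this]
    exact add_mem (Submodule.smul_mem _ _ (Submodule.subset_span ⟨_, rfl⟩))
      (Submodule.smul_mem _ _ (Submodule.subset_span ⟨_, rfl⟩))
  | zero =>
    simp only [Pi.zero_apply, mul_zero]
    exact zero_mem (Submodule.span ℝ (Set.range multiHermite))
  | add x y _ _ hx hy => simpa [mul_add] using! add_mem hx hy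
  | smul c x _ hx => simpa [mul_left_comm] using! Submodule.smul_mem _ c hx

theorem coordForm_pow_mem_span (L : ℕ →₀ ℝ) (k : ℕ) :
    (fun y => coordForm L y ^ k) ∈ Submodule.span ℝ (Set.range multiHermite) := by
  induction k with
  | zero =>
    refine Submodule.subset_span ⟨0, ?_⟩
    ext y; simp [multiHermite_zero]
  | succ k ih =>
    have : (fun y => coordForm L y ^ (k + 1)) =
        ∑ j ∈ L.support, L j • fun y : ℕ → ℝ => y j * coordForm L y ^ k := by
      ext y
      rw [pow_succ', coordForm, Finsupp.sum, Finset.sum_mul]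
      simp [mul_assoc, coordForm, Finsupp.sum]
    rw [this]
    exact Submodule.sum_mem _ fun j _ => Submodule.smul_mem _ _ (coord_mul_mem_span j ih)

theorem span_multiHermite_le {h : (ℕ → ℝ) → ℝ}
    (hh : h ∈ Submodule.span ℝ (Set.range multiHermite)) : h ∈ momentAlgebra := by
  have : Submodule.span ℝ (Set.range multiHermite) ≤ Subalgebra.toSubmodule momentAlgebra :=
    Submodule.span_le.2 (by rintro _ ⟨ν, rfl⟩; exact multiHermite_mem_momentAlgebra ν)
  exact this hh

theorem integral_mul_eq_zero_of_mem_span {g h : (ℕ → ℝ) → ℝ} (hg : MemLp g 2 gammaU)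
    (h0 : ∀ ν, hermiteCoeff g ν = 0) (hh : h ∈ Submodule.span ℝ (Set.range multiHermite)) :
    ∫ y, h y * g y ∂gammaU = 0 := by
  induction hh using Submodule.span_induction with
  | mem x hx =>
    obtain ⟨ν, rfl⟩ := hx
    exact h0 ν
  | zero => simp
  | add x y hx hy ihx ihy =>
    have h := integral_add (integrable_smul_of_mem_momentAlgebra (span_multiHermite_le hx) hg)
      (integrable_smul_of_mem_momentAlgebra (span_multiHermite_le hy) hg)
    simp only [smul_eq_mul, ihx, ihy, add_zero] at h
    simpa only [Pi.add_apply, add_mul] using h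
  | smul c x _ ih =>
    simp only [Pi.smul_apply, smul_eq_mul, mul_assoc]
    rw [integral_const_mul, ih, mul_zero]

/-- Expand `exp (i L)` in powers of `L`. Each power is a combination of Hermite polynomials, hence
orthogonal to `g`, and `exp |L| |g|` dominates the series. -/
theorem integral_cexp_mul_eq_zero {g : (ℕ → ℝ) → ℝ} (hg : MemLp g 2 gammaU)
    (h0 : ∀ ν, hermiteCoeff g ν = 0) (L : ℕ →₀ ℝ) :
    ∫ y, (g y : ℂ) * Complex.exp (coordForm L y * Complex.I) ∂gammaU = 0 := by
  have hs := hasSum_integral_of_dominated_convergence (μ := gammaU)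
    (F := fun (k : ℕ) y => (g y : ℂ) * ((coordForm L y * Complex.I) ^ k / (k.factorial : ℂ)))
    (f := fun y => (g y : ℂ) * Complex.exp (coordForm L y * Complex.I))
    (fun k y => |g y| * (|coordForm L y| ^ k / (k.factorial : ℝ))) (fun k => by
      have h1 := hg.aestronglyMeasurable
      have h2 := (measurable_coordForm L)
      refine AEStronglyMeasurable.mul (Complex.continuous_ofReal.comp_aestronglyMeasurable h1) ?_
      exact Measurable.aestronglyMeasurable (by fun_prop))
    (fun k => ae_of_all _ fun y => by simp)
    (ae_of_all _ fun y => (Real.summable_pow_div_factorial _).mul_left _)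
    (by
      have : ∀ y, ∑' k : ℕ, |g y| * (|coordForm L y| ^ k / (k.factorial : ℝ)) =
          Real.exp |coordForm L y| • |g y| := fun y => by
        rw [tsum_mul_left, Real.exp_eq_exp_ℝ, NormedSpace.exp_eq_tsum_div, smul_eq_mul, mul_comm]
      simp only [this]
      exact integrable_smul_of_mem_momentAlgebra (exp_abs_coordForm_mem_momentAlgebra L) hg.abs)
    (ae_of_all _ fun y => by
      refine HasSum.mul_left _ ?_
      rw [Complex.exp_eq_exp_ℂ]
      exact NormedSpace.expSeries_div_hasSum_exp _)
  refine hs.unique ?_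
  convert! hasSum_zero with k
  have e : ∀ y, (g y : ℂ) * ((coordForm L y * Complex.I) ^ k / (k.factorial : ℂ)) =
      (Complex.I ^ k / (k.factorial : ℂ)) * ((coordForm L y ^ k * g y : ℝ) : ℂ) := fun y => by
    push_cast; ring
  simp only [e]
  rw [integral_const_mul, integral_complex_ofReal,
    integral_mul_eq_zero_of_mem_span hg h0 (coordForm_pow_mem_span L k)]
  simp

/-- A finite measure on `ℝ^ℕ` is determined by the integrals of `exp (i L)` for the linear forms `L`
in finitely many coordinates. -/
theorem ext_of_integral_coordForm {P Q : Measure (ℕ → ℝ)} [IsFiniteMeasure P] [IsFiniteMeasure Q]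
    (h : ∀ L, ∫ y, Complex.exp (coordForm L y * Complex.I) ∂P =
      ∫ y, Complex.exp (coordForm L y * Complex.I) ∂Q) : P = Q := by
  let _ := TopologicalSpace.upgradeIsCompletelyMetrizable (ℕ → ℝ)
  -- With the discrete topology on the forms, joint continuity of the pairing reduces to continuity
  -- in `y` for each fixed `L`.
  let _ : TopologicalSpace (ℕ →₀ ℝ) := ⊥
  have : DiscreteTopology (ℕ →₀ ℝ) := ⟨rfl⟩
  let B : (ℕ → ℝ) →ₗ[ℝ] (ℕ →₀ ℝ) →ₗ[ℝ] ℝ := LinearMap.mk₂ ℝ (fun y L => coordForm L y)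
    (fun y z L => by simp [coordForm, Finsupp.sum, mul_add, Finset.sum_add_distrib])
    (fun c y L => by simp [coordForm, Finsupp.sum, mul_left_comm, Finset.mul_sum])
    (fun y L M => Finsupp.sum_add_index' (by simp) (by intros; ring))
    (fun c y L => by
      simp only [coordForm]
      rw [Finsupp.sum_smul_index' (by simp)]
      simp [Finsupp.sum, mul_assoc, Finset.mul_sum])
  have hB : ∀ y L, B y L = coordForm L y := fun _ _ => rfl
  refine ext_of_integral_char_eq (L := B) Real.continuous_probChar Real.probChar_ne_one
    (fun y hy hz => hy ?_) ?_ fun L => ?_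
  · ext j
    have := LinearMap.congr_fun hz (Finsupp.single j 1)
    simpa [hB, coordForm] using this
  · refine continuous_prod_of_discrete_right.2 fun L => ?_
    simp only [hB, coordForm, Finsupp.sum]
    fun_prop
  · simpa [BoundedContinuousFunction.char_apply, hB, Real.probChar_apply] using h L

/-- The positive and negative parts of `g` are densities of two finite measures with the same
characteristic function, so they agree almost everywhere; since one of them always vanishes, both
do. -/
theorem ae_eq_zero_of_hermiteCoeff_eq_zero {g : (ℕ → ℝ) → ℝ} (hg : MemLp g 2 gammaU)
    (h0 : ∀ ν, hermiteCoeff g ν = 0) : g =ᵐ[gammaU] 0 := by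
  have hi : Integrable g gammaU := hg.integrable (by norm_num)
  have f1 := hi.lintegral_lt_top
  have f2 := hi.neg.lintegral_lt_top
  have m1 : AEMeasurable (fun y => ENNReal.ofReal (g y)) gammaU :=
    hi.aestronglyMeasurable.aemeasurable.ennreal_ofReal
  have m2 : AEMeasurable (fun y => ENNReal.ofReal (-g y)) gammaU :=
    hi.aestronglyMeasurable.aemeasurable.neg.ennreal_ofReal
  have := isFiniteMeasure_withDensity f1.ne
  have := isFiniteMeasure_withDensity f2.ne
  have key : gammaU.withDensity (fun y => ENNReal.ofReal (g y)) =
      gammaU.withDensity (fun y => ENNReal.ofReal (-g y)) := by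
    refine ext_of_integral_coordForm fun L => ?_
    have hb : ∀ᵐ y ∂gammaU, ‖Complex.exp (coordForm L y * Complex.I)‖ ≤ 1 :=
      ae_of_all _ fun y => (Complex.norm_exp_ofReal_mul_I _).le
    have hm : AEStronglyMeasurable (fun y => Complex.exp (coordForm L y * Complex.I)) gammaU := by
      have := measurable_coordForm L
      exact Measurable.aestronglyMeasurable (by fun_prop)
    rw [integral_withDensity_eq_integral_toReal_smul₀ m1 (ae_of_all _ fun _ => by simp),
      integral_withDensity_eq_integral_toReal_smul₀ m2 (ae_of_all _ fun _ => by simp),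
      ← sub_eq_zero, ← integral_sub, ← integral_cexp_mul_eq_zero hg h0 L]
    · congr 1 with y
      rw [← sub_smul, Complex.real_smul]
      congr 2
      rcases le_total 0 (g y) with h | h
      · simp [ENNReal.toReal_ofReal h, ENNReal.ofReal_of_nonpos (neg_nonpos.2 h)]
      · simp [ENNReal.ofReal_of_nonpos h, ENNReal.toReal_ofReal (neg_nonneg.2 h)]
    · refine Integrable.smul_of_top_left (φ := fun y => (ENNReal.ofReal (g y)).toReal) ?_ ?_
      · simpa [ENNReal.toReal_ofReal'] using hi.pos_part
      · exact memLp_top_of_bound hm 1 hb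
    · refine Integrable.smul_of_top_left (φ := fun y => (ENNReal.ofReal (-g y)).toReal) ?_ ?_
      · simpa [ENNReal.toReal_ofReal'] using hi.neg_part
      · exact memLp_top_of_bound hm 1 hb
  have := (withDensity_eq_iff m1 m2 f1.ne).1 key
  filter_upwards [this] with y hy
  rcases le_total 0 (g y) with h | h
  · rw [ENNReal.ofReal_of_nonpos (neg_nonpos.2 h), ENNReal.ofReal_eq_zero] at hy
    exact le_antisymm hy h
  · rw [ENNReal.ofReal_of_nonpos h, eq_comm, ENNReal.ofReal_eq_zero] at hy
    exact le_antisymm h (neg_nonpos.1 hy)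

/-! ### Parseval's identity -/

noncomputable def hermiteLp (ν : ℕ →₀ ℕ) : Lp ℝ 2 gammaU :=
  (memLp_multiHermite ν (by simp)).toLp

theorem inner_hermiteLp (ν : ℕ →₀ ℕ) (g : Lp ℝ 2 gammaU) :
    inner ℝ (hermiteLp ν) g = hermiteCoeff g ν := by
  rw [L2.inner_def]
  refine integral_congr_ae ?_
  filter_upwards [(memLp_multiHermite ν (by simp)).coeFn_toLp (p := 2)] with y hy
  rw [hermiteLp, hy]
  simp [mul_comm]

theorem orthonormal_hermiteLp : Orthonormal ℝ hermiteLp := by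
  rw [orthonormal_iff_ite]
  intro ν μ
  rw [inner_hermiteLp, ← hermiteCoeff_multiHermite]
  refine integral_congr_ae ?_
  filter_upwards [(memLp_multiHermite μ (by simp)).coeFn_toLp (p := 2)] with y hy
  rw [hermiteLp, hy]

/-- The Hermite polynomials as a Hilbert basis of `L²(γ)`. -/
noncomputable def hermiteBasis : HilbertBasis (ℕ →₀ ℕ) ℝ (Lp ℝ 2 gammaU) :=
  HilbertBasis.mkOfOrthogonalEqBot orthonormal_hermiteLp (by
    rw [Submodule.eq_bot_iff]
    intro g hg
    rw [Lp.eq_zero_iff_ae_eq_zero]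
    refine ae_eq_zero_of_hermiteCoeff_eq_zero (Lp.memLp g) fun ν => ?_
    rw [← inner_hermiteLp]
    exact hg _ (Submodule.subset_span ⟨ν, rfl⟩))

theorem hasSum_hermiteCoeff_sq {g : (ℕ → ℝ) → ℝ} (hg : MemLp g 2 gammaU) :
    HasSum (fun ν => hermiteCoeff g ν ^ 2) (∫ y, g y ^ 2 ∂gammaU) := by
  have h := hermiteBasis.hasSum_inner_mul_inner hg.toLp hg.toLp
  have e1 : ∀ ν, inner ℝ (hermiteBasis ν) hg.toLp = hermiteCoeff g ν := fun ν => by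
    rw [hermiteBasis, HilbertBasis.coe_mkOfOrthogonalEqBot, inner_hermiteLp]
    refine integral_congr_ae ?_
    filter_upwards [hg.coeFn_toLp] with y hy
    rw [hy]
  have e2 : inner ℝ hg.toLp hg.toLp = ∫ y, g y ^ 2 ∂gammaU := by
    rw [L2.inner_def]
    refine integral_congr_ae ?_
    filter_upwards [hg.coeFn_toLp] with y hy
    rw [hy]; simp [sq]
  rw [e2] at h
  refine h.congr_fun fun ν => ?_
  rw [real_inner_comm, e1, sq]

section VectorParseval

variable {H : Type*} [NormedAddCommGroup H] [InnerProductSpace ℝ H] [CompleteSpace H]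

theorem hermiteCoeff_clm {E F : Type*} [NormedAddCommGroup E] [NormedSpace ℝ E] [CompleteSpace E]
    [NormedAddCommGroup F] [NormedSpace ℝ F] [CompleteSpace F] (T : E →L[ℝ] F) {w : (ℕ → ℝ) → E}
    (hw : MemLp w 2 gammaU) (ν : ℕ →₀ ℕ) :
    hermiteCoeff (fun y => T (w y)) ν = T (hermiteCoeff w ν) := by
  rw [hermiteCoeff, hermiteCoeff, ← T.integral_comp_comm (integrable_multiHermite_smul ν hw)]
  simp

omit [CompleteSpace H] in
theorem HilbertBasis.tsum_ofReal_inner_sq {ι : Type*} (b : HilbertBasis ι ℝ H) (x : H) :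
    ∑' i, ENNReal.ofReal (inner ℝ (b i) x ^ 2) = ENNReal.ofReal (‖x‖ ^ 2) := by
  have h := b.hasSum_inner_mul_inner x x
  rw [real_inner_self_eq_norm_sq] at h
  have h' : HasSum (fun i => inner ℝ (b i) x ^ 2) (‖x‖ ^ 2) :=
    h.congr_fun fun i => by rw [real_inner_comm, sq]
  rw [← h'.tsum_eq, ENNReal.ofReal_tsum_of_nonneg (fun i => sq_nonneg _) h'.summable]

-- Distinct members are at distance `√2`, so balls of radius `1/2` around them are disjoint, and
-- separability bounds their number.
omit [CompleteSpace H] in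
theorem Orthonormal.countable [SecondCountableTopology H] {ι : Type*} {v : ι → H}
    (hv : Orthonormal ℝ v) : Countable ι := by
  refine Pairwise.countable_of_isOpen_disjoint (s := fun i => Metric.ball (v i) (1 / 2))
    (fun i j hij => Metric.ball_disjoint_ball ?_) (fun i => Metric.isOpen_ball)
    fun i => ⟨v i, Metric.mem_ball_self (by norm_num)⟩
  have h : ‖v i - v j‖ ^ 2 = 2 := by
    rw [norm_sub_sq_real, hv.1 i, hv.1 j, hv.2 hij]; norm_num
  rw [dist_eq_norm]
  nlinarith [norm_nonneg (v i - v j)]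

/-- Parseval's identity for Hilbert space valued functions. -/
theorem lintegral_norm_sq_eq_tsum_hermiteCoeff [SecondCountableTopology H] {w : (ℕ → ℝ) → H}
    (hw : MemLp w 2 gammaU) :
    ∫⁻ y, ENNReal.ofReal (‖w y‖ ^ 2) ∂gammaU =
      ∑' ν, ENNReal.ofReal (‖hermiteCoeff w ν‖ ^ 2) := by
  -- Scalar Parseval is applied to each coordinate in a basis of `H`. Countability of the basis is
  -- needed to exchange the sum with the integral.
  obtain ⟨s, b, -⟩ := exists_hilbertBasis ℝ H
  have : Countable s := b.orthonormal.countable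
  have hi : ∀ i, MemLp (fun y => inner ℝ (b i) (w y)) 2 gammaU := fun i => hw.const_inner (b i)
  simp only [← b.tsum_ofReal_inner_sq]
  rw [lintegral_tsum fun i => ((hi i).aestronglyMeasurable.aemeasurable.pow_const 2).ennreal_ofReal,
    ENNReal.tsum_comm]
  refine tsum_congr fun i => ?_
  have h := hasSum_hermiteCoeff_sq (hi i)
  rw [← ofReal_integral_eq_lintegral_ofReal ((hi i).integrable_sq) (ae_of_all _ fun y => sq_nonneg _),
    ← h.tsum_eq, ENNReal.ofReal_tsum_of_nonneg (fun i => sq_nonneg _) h.summable]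
  refine tsum_congr fun ν => ?_
  rw [← innerSL_apply_apply ℝ, ← hermiteCoeff_clm _ hw]
  simp

end VectorParseval

/-! ### Multiplication operators -/

section Multiplication

variable {α : Type*} [MeasurableSpace α] {m : Measure α}
  {F : Type*} [NormedAddCommGroup F] [InnerProductSpace ℝ F]

/-- Multiplication by an `L^∞` function on `L²`. -/
noncomputable def mulOp : Lp ℝ ∞ m →L[ℝ] (Lp F 2 m →L[ℝ] Lp F 2 m) :=
  (ContinuousLinearMap.lsmul ℝ ℝ).holderL m ∞ 2 2

theorem coeFn_mulOp (B : Lp ℝ ∞ m) (g : Lp F 2 m) :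
    mulOp B g =ᵐ[m] fun x => B x • g x :=
  ContinuousLinearMap.coeFn_holder (r := 2) (ContinuousLinearMap.lsmul ℝ ℝ) B g

theorem ae_abs_le_norm (B : Lp ℝ ∞ m) : ∀ᵐ x ∂m, |B x| ≤ ‖B‖ := by
  filter_upwards [ae_le_eLpNormEssSup (f := B) (μ := m)] with x hx
  rw [← eLpNorm_exponent_top] at hx
  have := ENNReal.toReal_mono (Lp.eLpNorm_ne_top B) hx
  simpa [Lp.norm_def] using this

theorem memLp_exp (B : Lp ℝ ∞ m) : MemLp (fun x => Real.exp (B x)) ∞ m := by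
  refine memLp_top_of_bound
    (Real.continuous_exp.comp_aestronglyMeasurable (Lp.aestronglyMeasurable B)) (Real.exp ‖B‖) ?_
  filter_upwards [ae_abs_le_norm B] with x hx
  rw [Real.norm_eq_abs, Real.abs_exp]
  exact Real.exp_le_exp.2 ((le_abs_self _).trans hx)

/-- Multiplication by `exp B` on `L²`. -/
noncomputable def expOp (B : Lp ℝ ∞ m) : Lp F 2 m →L[ℝ] Lp F 2 m := mulOp (memLp_exp B).toLp

theorem coeFn_expOp (B : Lp ℝ ∞ m) (g : Lp F 2 m) :
    expOp B g =ᵐ[m] fun x => Real.exp (B x) • g x := by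
  filter_upwards [coeFn_mulOp (memLp_exp B).toLp g, (memLp_exp B).coeFn_toLp] with x h1 h2
  rw [expOp, h1, h2]

theorem norm_expOp_le (B : Lp ℝ ∞ m) : ‖(expOp B : Lp F 2 m →L[ℝ] Lp F 2 m)‖ ≤ Real.exp ‖B‖ := by
  refine ContinuousLinearMap.opNorm_le_bound _ (Real.exp_pos _).le fun g =>
    Lp.norm_le_mul_norm_of_ae_le_mul ?_
  filter_upwards [coeFn_expOp B g, ae_abs_le_norm B] with x h1 h2
  rw [h1, norm_smul, Real.norm_eq_abs, Real.abs_exp]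
  gcongr
  exact (le_abs_self _).trans h2

theorem expOp_add (B C : Lp ℝ ∞ m) :
    (expOp (B + C) : Lp F 2 m →L[ℝ] Lp F 2 m) = expOp C * expOp B := by
  ext1 g
  apply Lp.ext
  filter_upwards [coeFn_expOp (B + C) g, coeFn_expOp C (expOp B g), coeFn_expOp B g,
    Lp.coeFn_add B C] with x h1 h2 h3 h4
  rw [h1, mul_apply_eq_comp, h2, h3, h4, smul_smul, Pi.add_apply, Real.exp_add,
    mul_comm]

theorem expOp_zero : (expOp (0 : Lp ℝ ∞ m) : Lp F 2 m →L[ℝ] Lp F 2 m) = 1 := by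
  ext1 g
  apply Lp.ext
  filter_upwards [coeFn_expOp (0 : Lp ℝ ∞ m) g, Lp.coeFn_zero ℝ ∞ m] with x h1 h2
  rw [h1, h2]; simp

/-- The pointwise bound `|exp t - 1 - t| ≤ t²` for `|t| ≤ 1`; it yields differentiability of the
exponential at `0`, and the group law carries this to every point. -/
theorem norm_expOp_sub_sub_le {C : Lp ℝ ∞ m} (hC : ‖C‖ ≤ 1) :
    ‖(expOp C : Lp F 2 m →L[ℝ] Lp F 2 m) - 1 - mulOp C‖ ≤ ‖C‖ ^ 2 := by
  refine ContinuousLinearMap.opNorm_le_bound _ (by positivity) fun g =>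
    Lp.norm_le_mul_norm_of_ae_le_mul ?_
  simp only [sub_apply, one_apply_eq_self]
  filter_upwards [coeFn_expOp C g, coeFn_mulOp C g, ae_abs_le_norm C,
    Lp.coeFn_sub (expOp C g - g) (mulOp C g), Lp.coeFn_sub (expOp C g) g] with x h1 h2 h3 h4 h5
  rw [h4, Pi.sub_apply, h5, Pi.sub_apply, h1, h2]
  have e : Real.exp (C x) • g x - g x - C x • g x = (Real.exp (C x) - 1 - C x) • g x := by module
  rw [e, norm_smul]
  gcongr
  rw [Real.norm_eq_abs]
  refine (Real.abs_exp_sub_one_sub_id_le (h3.trans hC)).trans ?_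
  rw [← sq_abs]
  gcongr

theorem inner_expOp_ge (B : Lp ℝ ∞ m) (g : Lp F 2 m) :
    Real.exp (-‖B‖) * ‖g‖ ^ 2 ≤ inner ℝ (expOp B g) g := by
  rw [← real_inner_self_eq_norm_sq, L2.inner_def, L2.inner_def, ← integral_const_mul]
  refine integral_mono_ae ((L2.integrable_inner g g).const_mul _) (L2.integrable_inner _ _) ?_
  filter_upwards [coeFn_expOp B g, ae_abs_le_norm B] with x h1 h2
  simp only [h1, real_inner_smul_left]
  refine mul_le_mul_of_nonneg_right (Real.exp_le_exp.2 ?_) real_inner_self_nonneg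
  exact neg_le.2 ((neg_le_abs _).trans h2)

/-- A family of operators on a Hilbert space that behaves like the exponential of a commuting
linear family `M` of bounded self-adjoint operators. -/
structure IsExpFamily {X Q : Type*} [NormedAddCommGroup X] [NormedSpace ℝ X]
    [NormedAddCommGroup Q] [InnerProductSpace ℝ Q] (M : X →L[ℝ] (Q →L[ℝ] Q))
    (Ex : X → (Q →L[ℝ] Q)) : Prop where
  map_zero : Ex 0 = 1
  map_add : ∀ B C, Ex (B + C) = Ex C * Ex B
  norm_sub_sub_le : ∀ C, ‖C‖ ≤ 1 → ‖Ex C - 1 - M C‖ ≤ ‖C‖ ^ 2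
  norm_le : ∀ B, ‖Ex B‖ ≤ Real.exp ‖B‖
  le_inner : ∀ B g, Real.exp (-‖B‖) * ‖g‖ ^ 2 ≤ inner ℝ (Ex B g) g

theorem isExpFamily_expOp : IsExpFamily (X := Lp ℝ ∞ m) (Q := Lp F 2 m) mulOp expOp :=
  ⟨expOp_zero, expOp_add, fun _ => norm_expOp_sub_sub_le, norm_expOp_le, inner_expOp_ge⟩

end Multiplication

/-! ### The Poincaré inequality -/

/-- Since `∂_i x_i = 1`, integration by parts gives `∫ φ² = -∫ 2 φ (∂_i φ) x_i`. By Young's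
inequality this is at most `½ ∫ φ² + 2R² ∫ |∇φ|²`, and the first term is absorbed. -/
theorem integral_sq_le_integral_gradient_sq {d : ℕ} (hd : 0 < d) {φ : Pt d → ℝ}
    (hφ : ContDiff ℝ ∞ φ) (hc : HasCompactSupport φ) {R : ℝ} (hR : ∀ x ∈ tsupport φ, ‖x‖ ≤ R) :
    ∫ x, φ x ^ 2 ≤ 4 * R ^ 2 * ∫ x, ‖gradient φ x‖ ^ 2 := by
  let i : Fin d := ⟨0, hd⟩
  let v : Pt d := EuclideanSpace.single i 1
  let c : Pt d →L[ℝ] ℝ := EuclideanSpace.proj i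
  have hdφ : Differentiable ℝ φ := hφ.differentiable (by simp)
  have hcf : HasCompactSupport (fderiv ℝ φ) := hc.fderiv ℝ
  have hcont : Continuous (fderiv ℝ φ) := hφ.continuous_fderiv (by simp)
  have hgn : ∀ x, ‖gradient φ x‖ = ‖fderiv ℝ φ x‖ := fun x => by simp [gradient]
  have hf : ∀ x, fderiv ℝ (fun x => φ x ^ 2) x v = 2 * φ x * fderiv ℝ φ x v := fun x => by
    rw [((hdφ x).hasFDerivAt.pow 2).fderiv]
    simp
  have hcsq : HasCompactSupport (fun x => φ x ^ 2) := by
    simpa [sq] using! hc.mul_left (f := φ)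
  have cφ : Continuous φ := hφ.continuous
  have hmc : ∀ h : Pt d → ℝ, Continuous h →
      Integrable (fun x => (2 * φ x * fderiv ℝ φ x v) * h x) := fun h hh => by
    refine Continuous.integrable_of_hasCompactSupport (by fun_prop) ?_
    exact HasCompactSupport.mul_right (HasCompactSupport.mul_right (hc.mul_left))
  have hI := integral_mul_fderiv_eq_neg_fderiv_mul_of_integrable (μ := volume)
    (f := fun x => φ x ^ 2) (g := c) (v := v)
    (by simpa only [hf] using hmc c c.continuous)
    (by
      simp only [ContinuousLinearMap.fderiv]
      exact (Continuous.integrable_of_hasCompactSupport (by fun_prop) hcsq).mul_const _)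
    (Continuous.integrable_of_hasCompactSupport (by fun_prop) hcsq.mul_right)
    (fun x _ => (hdφ x).pow 2) fun x _ => c.differentiableAt
  have hcv : c v = 1 := by simp [c, v]
  simp only [ContinuousLinearMap.fderiv, hcv, mul_one, hf] at hI
  have hiφ : Integrable (fun x => φ x ^ 2) :=
    Continuous.integrable_of_hasCompactSupport (by fun_prop) hcsq
  have hig : Integrable (fun x => ‖gradient φ x‖ ^ 2) := by
    simp only [hgn]
    refine Continuous.integrable_of_hasCompactSupport (by fun_prop) ?_
    exact (hcf.norm).comp_left (g := fun t : ℝ => t ^ 2) (by simp)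
  have hle : ∫ x, φ x ^ 2 ≤ ∫ x, ((1 / 2) * φ x ^ 2 + 2 * R ^ 2 * ‖gradient φ x‖ ^ 2) := by
    rw [hI, ← integral_neg]
    refine integral_mono (hmc c c.continuous).neg
      ((hiφ.const_mul _).add (hig.const_mul _)) fun x => ?_
    simp only
    by_cases hx : x ∈ tsupport φ
    · have h1 : |c x| ≤ R := (PiLp.norm_apply_le x i).trans (hR x hx)
      have h2 : |fderiv ℝ φ x v| ≤ ‖gradient φ x‖ := by
        rw [hgn]
        simpa [v] using (fderiv ℝ φ x).le_opNorm v
      have h3 : |fderiv ℝ φ x v * c x| ≤ ‖gradient φ x‖ * R := by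
        rw [abs_mul]; gcongr
      have h4 : (fderiv ℝ φ x v * c x) ^ 2 ≤ (‖gradient φ x‖ * R) ^ 2 := sq_le_sq'
        (abs_le.1 h3).1 (abs_le.1 h3).2
      nlinarith [sq_nonneg (φ x + 2 * (fderiv ℝ φ x v * c x))]
    · rw [image_eq_zero_of_notMem_tsupport hx]
      simp only [mul_zero, zero_mul, neg_zero]
      positivity
  rw [integral_add (hiφ.const_mul _) (hig.const_mul _), integral_const_mul,
    integral_const_mul] at hle
  linarith

variable {d : ℕ} {D : Set (Pt d)}

theorem norm_sq_eq_integral {F : Type*} [NormedAddCommGroup F] [InnerProductSpace ℝ F]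
    {φ : Pt d → F} (w : Lp F 2 (vol D)) (h : w =ᵐ[vol D] φ) (hs : ∀ x ∉ D, φ x = 0) :
    ‖w‖ ^ 2 = ∫ x, ‖φ x‖ ^ 2 := by
  rw [← setIntegral_eq_integral_of_forall_compl_eq_zero (s := D)
    (fun x hx => by simp [hs x hx]), ← real_inner_self_eq_norm_sq, L2.inner_def]
  refine integral_congr_ae ?_
  filter_upwards [h] with x hx
  rw [hx, real_inner_self_eq_norm_sq]

/-- The Poincaré inequality on a bounded set: the gradient norm controls the `H¹` norm. -/
theorem exists_norm_sq_le_gradNorm (hd : 0 < d) (hDb : Bornology.IsBounded D) :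
    ∃ K > 0, ∀ v : HOneZero D, ‖v‖ ^ 2 ≤ K * ‖v.grad‖ ^ 2 := by
  obtain ⟨R, hR⟩ := hDb.exists_norm_le
  refine ⟨4 * R ^ 2 + 1, by positivity, fun v => ?_⟩
  have key : ∀ w ∈ testPairs D, ‖w.fst‖ ^ 2 ≤ 4 * R ^ 2 * ‖w.snd‖ ^ 2 := by
    rintro w ⟨φ, hs, hc, ht, hf, hg⟩
    have hz : ∀ x ∉ D, x ∉ tsupport φ := fun x hx h => hx (ht h)
    rw [norm_sq_eq_integral w.fst hf fun x hx => image_eq_zero_of_notMem_tsupport (hz x hx),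
      norm_sq_eq_integral w.snd hg fun x hx => by
        have : fderiv ℝ φ x = 0 :=
          image_eq_zero_of_notMem_tsupport fun h => hz x hx (tsupport_fderiv_subset ℝ h)
        simp [gradient, this]]
    simpa using integral_sq_le_integral_gradient_sq hd hs hc fun x hx => hR x (ht hx)
  -- The inequality is a closed condition, so it passes from test pairs to their closure.
  have hcl : (v : GraphSpace D) ∈ {w : GraphSpace D | ‖w.fst‖ ^ 2 ≤ 4 * R ^ 2 * ‖w.snd‖ ^ 2} := by
    have hcl : IsClosed {w : GraphSpace D | ‖w.fst‖ ^ 2 ≤ 4 * R ^ 2 * ‖w.snd‖ ^ 2} :=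
      isClosed_le (by fun_prop) (by fun_prop)
    exact hcl.closure_subset_iff.2 key v.2
  have hn : ‖v‖ ^ 2 = ‖(v : GraphSpace D).fst‖ ^ 2 + ‖(v : GraphSpace D).snd‖ ^ 2 :=
    WithLp.prod_norm_sq_eq_of_L2 _
  have hcl' : ‖(v : GraphSpace D).fst‖ ^ 2 ≤ 4 * R ^ 2 * ‖(v : GraphSpace D).snd‖ ^ 2 := hcl
  rw [hn, HOneZero.grad]
  linarith

/-! ### The solution operator and its derivatives -/

section SolutionOperator

variable {X Q V : Type*} [NormedAddCommGroup X] [NormedSpace ℝ X]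
  [NormedAddCommGroup Q] [InnerProductSpace ℝ Q] [CompleteSpace Q]
  [NormedAddCommGroup V] [InnerProductSpace ℝ V] [CompleteSpace V]

namespace IsExpFamily

variable {M : X →L[ℝ] (Q →L[ℝ] Q)} {Ex : X → (Q →L[ℝ] Q)}

omit [CompleteSpace Q] in
theorem hasFDerivAt_zero (h : IsExpFamily M Ex) : HasFDerivAt Ex M 0 := by
  rw [hasFDerivAt_iff_isLittleO]
  refine Asymptotics.IsBigO.trans_isLittleO (g := fun C : X => ‖C‖ ^ 2) ?_ ?_
  · refine Asymptotics.IsBigO.of_bound 1 ?_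
    filter_upwards [Metric.ball_mem_nhds (0 : X) one_pos] with C hC
    simpa [h.map_zero] using h.norm_sub_sub_le C (mem_ball_zero_iff.1 hC).le
  · simpa using Asymptotics.isLittleO_norm_pow_id (E' := X) one_lt_two

omit [CompleteSpace Q] in
theorem hasDerivAt (h : IsExpFamily M Ex) (B ψ : X) :
    HasDerivAt (fun t : ℝ => Ex (B + t • ψ)) (M ψ * Ex B) 0 := by
  simp only [h.map_add]
  have h1 : HasDerivAt (fun t : ℝ => t • ψ) ψ 0 := by
    simpa using (hasDerivAt_id (0 : ℝ)).smul_const ψ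
  have h0 : HasFDerivAt Ex M ((0 : ℝ) • ψ) := by
    rw [zero_smul]; exact h.hasFDerivAt_zero
  exact (h0.comp_hasDerivAt (0 : ℝ) h1).mul_const (Ex B)

omit [CompleteSpace Q] in
theorem continuous (h : IsExpFamily M Ex) : Continuous Ex := by
  rw [continuous_iff_continuousAt]
  intro B
  have h1 : ContinuousAt (fun C : X => Ex (C - B) * Ex B) B := by
    refine ContinuousAt.mul ?_ continuousAt_const
    refine ContinuousAt.comp (f := fun C => C - B) (g := Ex) ?_ (by fun_prop)
    rw [sub_self]
    exact h.hasFDerivAt_zero.continuousAt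
  have e : (fun C : X => Ex (C - B) * Ex B) = Ex := by
    ext1 C; rw [← h.map_add, add_sub_cancel]
  rwa [e] at h1

end IsExpFamily

/-- `T ↦ G† T G`. -/
noncomputable def sandwich (G : V →L[ℝ] Q) : (Q →L[ℝ] Q) →L[ℝ] (V →L[ℝ] V) :=
  (ContinuousLinearMap.compL ℝ V Q V (ContinuousLinearMap.adjoint G)).comp
    ((ContinuousLinearMap.compL ℝ V Q Q).flip G)

theorem inner_sandwich (G : V →L[ℝ] Q) (T : Q →L[ℝ] Q) (v w : V) :
    inner ℝ (sandwich G T v) w = inner ℝ (T (G v)) (G w) := by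
  simp [sandwich, ContinuousLinearMap.adjoint_inner_left]

/-- The inverse of `G† exp(B) G`. -/
noncomputable def solOp (G : V →L[ℝ] Q) (Ex : X → (Q →L[ℝ] Q)) (B : X) : V →L[ℝ] V :=
  Ring.inverse (sandwich G (Ex B))

/-- The class of functions generated from the solution map under differentiation. -/
inductive SolutionClass (G : V →L[ℝ] Q) (Ex : X → (Q →L[ℝ] Q)) (f : V) : (X → V) → Prop
  | base : SolutionClass G Ex f fun B => solOp G Ex B f
  | step (c : Q →L[ℝ] Q) {F : X → V} : SolutionClass G Ex f F →
      SolutionClass G Ex f fun B => solOp G Ex B (sandwich G (c * Ex B) (F B))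
  | add {F₁ F₂ : X → V} : SolutionClass G Ex f F₁ → SolutionClass G Ex f F₂ →
      SolutionClass G Ex f fun B => F₁ B + F₂ B
  | neg {F : X → V} : SolutionClass G Ex f F → SolutionClass G Ex f fun B => -F B

variable {M : X →L[ℝ] (Q →L[ℝ] Q)} {Ex : X → (Q →L[ℝ] Q)} {G : V →L[ℝ] Q} {f : V} {K : ℝ}

theorem le_inner_sandwich (h : IsExpFamily M Ex) (hK : 0 < K)
    (hG : ∀ v, ‖v‖ ^ 2 ≤ K * ‖G v‖ ^ 2) (B : X) (v : V) :
    ‖v‖ ^ 2 * (Real.exp (-‖B‖) / K) ≤ inner ℝ (sandwich G (Ex B) v) v := by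
  rw [inner_sandwich]
  refine le_trans ?_ (h.le_inner B (G v))
  have h1 := mul_le_mul_of_nonneg_left (hG v) (div_pos (Real.exp_pos (-‖B‖)) hK).le
  have e : Real.exp (-‖B‖) / K * (K * ‖G v‖ ^ 2) = Real.exp (-‖B‖) * ‖G v‖ ^ 2 := by
    field_simp
  linarith

/-- The Lax–Milgram argument: a bounded coercive operator on a Hilbert space is invertible. -/
theorem isUnit_sandwich (h : IsExpFamily M Ex) (hK : 0 < K)
    (hG : ∀ v, ‖v‖ ^ 2 ≤ K * ‖G v‖ ^ 2) (B : X) : IsUnit (sandwich G (Ex B)) :=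
  ContinuousLinearMap.isUnit_of_forall_le_norm_inner_map _
    (c := ⟨Real.exp (-‖B‖) / K, by positivity⟩) (div_pos (Real.exp_pos _) hK) fun v =>
    (le_inner_sandwich h hK hG B v).trans (le_abs_self _)

theorem sandwich_solOp (h : IsExpFamily M Ex) (hK : 0 < K)
    (hG : ∀ v, ‖v‖ ^ 2 ≤ K * ‖G v‖ ^ 2) (B : X) (v : V) :
    sandwich G (Ex B) (solOp G Ex B v) = v :=
  DFunLike.congr_fun (Ring.mul_inverse_cancel _ (isUnit_sandwich h hK hG B)) v

theorem solOp_sandwich (h : IsExpFamily M Ex) (hK : 0 < K)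
    (hG : ∀ v, ‖v‖ ^ 2 ≤ K * ‖G v‖ ^ 2) (B : X) (v : V) :
    solOp G Ex B (sandwich G (Ex B) v) = v :=
  DFunLike.congr_fun (Ring.inverse_mul_cancel _ (isUnit_sandwich h hK hG B)) v

theorem norm_solOp_le (h : IsExpFamily M Ex) (hK : 0 < K)
    (hG : ∀ v, ‖v‖ ^ 2 ≤ K * ‖G v‖ ^ 2) (B : X) :
    ‖solOp G Ex B‖ ≤ K * Real.exp ‖B‖ := by
  refine ContinuousLinearMap.opNorm_le_bound _ (by positivity) fun v => ?_
  set w := solOp G Ex B v with hw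
  have h1 := le_inner_sandwich h hK hG B w
  rw [hw, sandwich_solOp h hK hG, ← hw] at h1
  have h2 : ‖w‖ ^ 2 * (Real.exp (-‖B‖) / K) ≤ ‖v‖ * ‖w‖ :=
    h1.trans (real_inner_le_norm _ _)
  rcases (norm_nonneg w).eq_or_lt with h0 | h0
  · rw [← h0]; positivity
  have h3 : ‖w‖ * (Real.exp (-‖B‖) / K) ≤ ‖v‖ := by
    refine le_of_mul_le_mul_right ?_ h0
    linarith
  rw [Real.exp_neg] at h3
  have h4 := mul_le_mul_of_nonneg_left h3 (mul_pos hK (Real.exp_pos ‖B‖)).le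
  have e : K * Real.exp ‖B‖ * (‖w‖ * ((Real.exp ‖B‖)⁻¹ / K)) = ‖w‖ := by
    have := (Real.exp_pos ‖B‖).ne'
    field_simp
  linarith

/-- The rule `(A⁻¹)' = -A⁻¹ A' A⁻¹` for the inverse in a Banach algebra. -/
theorem hasDerivAt_solOp (h : IsExpFamily M Ex) (hK : 0 < K)
    (hG : ∀ v, ‖v‖ ^ 2 ≤ K * ‖G v‖ ^ 2) (B ψ : X) :
    HasDerivAt (fun t : ℝ => solOp G Ex (B + t • ψ))
      (-(solOp G Ex B * sandwich G (M ψ * Ex B) * solOp G Ex B)) 0 := by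
  have h1 : HasDerivAt (fun t : ℝ => sandwich G (Ex (B + t • ψ))) (sandwich G (M ψ * Ex B)) 0 :=
    (sandwich G).hasFDerivAt.comp_hasDerivAt (0 : ℝ) (h.hasDerivAt B ψ)
  obtain ⟨u, hu⟩ := isUnit_sandwich h hK hG B
  have h2 : HasFDerivAt Ring.inverse (-ContinuousLinearMap.mulLeftRight ℝ (V →L[ℝ] V) ↑u⁻¹ ↑u⁻¹)
      (sandwich G (Ex (B + (0 : ℝ) • ψ))) := by
    rw [zero_smul, add_zero, ← hu]
    exact hasFDerivAt_ringInverse u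
  have hr : solOp G Ex B = ↑u⁻¹ := by rw [solOp, ← hu, Ring.inverse_unit]
  have h3 := h2.comp_hasDerivAt (0 : ℝ) h1
  simpa [hr] using! h3

theorem continuous_solOp (h : IsExpFamily M Ex) (hK : 0 < K)
    (hG : ∀ v, ‖v‖ ^ 2 ≤ K * ‖G v‖ ^ 2) : Continuous (solOp G Ex) := by
  rw [continuous_iff_continuousAt]
  intro B
  obtain ⟨u, hu⟩ := isUnit_sandwich h hK hG B
  refine ContinuousAt.comp (g := Ring.inverse) (f := fun B => sandwich G (Ex B)) ?_
    ((sandwich G).continuous.comp h.continuous).continuousAt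
  rw [← hu]
  exact NormedRing.inverse_continuousAt u

namespace SolutionClass

theorem continuous (h : IsExpFamily M Ex) (hK : 0 < K)
    (hG : ∀ v, ‖v‖ ^ 2 ≤ K * ‖G v‖ ^ 2) {F : X → V} (hF : SolutionClass G Ex f F) :
    Continuous F := by
  have hR := continuous_solOp h hK hG
  induction hF with
  | base => exact hR.clm_apply continuous_const
  | step c _ ih =>
    exact hR.clm_apply (((sandwich G).continuous.comp
      (continuous_const.mul h.continuous)).clm_apply ih)
  | add _ _ ih₁ ih₂ => exact ih₁.add ih₂
  | neg _ ih => exact ih.neg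

theorem exists_norm_le (h : IsExpFamily M Ex) (hK : 0 < K)
    (hG : ∀ v, ‖v‖ ^ 2 ≤ K * ‖G v‖ ^ 2) {F : X → V} (hF : SolutionClass G Ex f F) :
    ∃ C k : ℝ, 0 ≤ C ∧ 0 ≤ k ∧ ∀ B, ‖F B‖ ≤ C * Real.exp (k * ‖B‖) := by
  have hR := norm_solOp_le h hK hG
  induction hF with
  | base =>
    refine ⟨K * ‖f‖, 1, by positivity, by norm_num, fun B => ?_⟩
    refine ((solOp G Ex B).le_of_opNorm_le (hR B) f).trans (le_of_eq ?_)
    rw [one_mul]; ring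
  | step c _ ih =>
    obtain ⟨C, k, hC, hk, hb⟩ := ih
    -- The exponent grows by two: one factor `exp ‖B‖` from the inverse and one from `Ex B`.
    refine ⟨K * (‖sandwich G‖ * ‖c‖) * C, k + 2, by positivity, by positivity, fun B => ?_⟩
    have h1 : ‖sandwich G (c * Ex B)‖ ≤ ‖sandwich G‖ * (‖c‖ * Real.exp ‖B‖) :=
      (sandwich G).le_opNorm_of_le ((norm_mul_le _ _).trans (by gcongr; exact h.norm_le B))
    have h2 := (solOp G Ex B).le_of_opNorm_le_of_le (hR B)
      ((sandwich G (c * Ex B)).le_of_opNorm_le_of_le h1 (hb B))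
    refine h2.trans (le_of_eq ?_)
    have e : Real.exp ((k + 2) * ‖B‖) = Real.exp ‖B‖ * Real.exp ‖B‖ * Real.exp (k * ‖B‖) := by
      rw [← Real.exp_add, ← Real.exp_add]; ring_nf
    rw [e]; ring
  | add _ _ ih₁ ih₂ =>
    obtain ⟨C₁, k₁, hC₁, hk₁, hb₁⟩ := ih₁
    obtain ⟨C₂, k₂, hC₂, hk₂, hb₂⟩ := ih₂
    refine ⟨C₁ + C₂, k₁ + k₂, by positivity, by positivity, fun B => ?_⟩
    refine (norm_add_le _ _).trans ?_
    rw [add_mul C₁ C₂]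
    refine add_le_add ((hb₁ B).trans ?_) ((hb₂ B).trans ?_)
    · gcongr; linarith
    · gcongr; linarith
  | neg _ ih => simpa using ih

/-- Closure under differentiation is why `step` allows an arbitrary operator `c`: differentiating `c
* Ex B` along `ψ` replaces `c` by `c * M ψ`. -/
theorem exists_hasDerivAt (h : IsExpFamily M Ex) (hK : 0 < K)
    (hG : ∀ v, ‖v‖ ^ 2 ≤ K * ‖G v‖ ^ 2) {F : X → V} (hF : SolutionClass G Ex f F) (ψ : X) :
    ∃ F', SolutionClass G Ex f F' ∧
      ∀ B, HasDerivAt (fun t : ℝ => F (B + t • ψ)) (F' B) 0 := by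
  have hR := fun B => hasDerivAt_solOp h hK hG B ψ
  induction hF with
  | base =>
    refine ⟨_, (base.step (M ψ)).neg, fun B => ?_⟩
    simpa using (hR B).clm_apply (hasDerivAt_const (0 : ℝ) f)
  | @step c F hF ih =>
    obtain ⟨F', hF', hd⟩ := ih
    -- Product rule: the three summands differentiate the outer inverse, the factor `Ex B` and the
    -- inner function `F`.
    refine ⟨_, (((hF.step c).step (M ψ)).neg.add (hF.step (c * M ψ))).add (hF'.step c),
      fun B => ?_⟩
    have h1 : HasDerivAt (fun t : ℝ => sandwich G (c * Ex (B + t • ψ)))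
        (sandwich G (c * (M ψ * Ex B))) 0 :=
      (sandwich G).hasFDerivAt.comp_hasDerivAt (0 : ℝ) ((h.hasDerivAt B ψ).const_mul c)
    have h2 := (hR B).clm_apply (h1.clm_apply (hd B))
    refine h2.congr_deriv ?_
    simp [mul_assoc, add_assoc]
  | add _ _ ih₁ ih₂ =>
    obtain ⟨F₁, hF₁, hd₁⟩ := ih₁
    obtain ⟨F₂, hF₂, hd₂⟩ := ih₂
    exact ⟨_, hF₁.add hF₂, fun B => (hd₁ B).add (hd₂ B)⟩
  | neg _ ih =>
    obtain ⟨F', hF', hd⟩ := ih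
    exact ⟨_, hF'.neg, fun B => (hd B).neg⟩

end SolutionClass

end SolutionOperator

/-! ### Multi-index combinatorics -/

theorem multiFactorial_pos (μ : ℕ →₀ ℕ) : 0 < multiFactorial μ :=
  Finset.prod_pos fun _ _ => Nat.factorial_pos _

theorem multiFactorial_eq_mul_erase (ν : ℕ →₀ ℕ) (j : ℕ) :
    multiFactorial ν = (ν j).factorial * multiFactorial (ν.erase j) :=
  (Finsupp.mul_prod_erase' ν j (fun _ m => m.factorial) fun _ => rfl).symm

theorem multiFactorial_add_single (ν : ℕ →₀ ℕ) (j : ℕ) :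
    multiFactorial (ν + Finsupp.single j 1) = (ν j + 1) * multiFactorial ν := by
  rw [multiFactorial_eq_mul_erase _ j, multiFactorial_eq_mul_erase ν j, erase_add_single]
  simp [Nat.factorial_succ, mul_assoc]

theorem multiFactorial_add (ν μ : ℕ →₀ ℕ) :
    multiFactorial (ν + μ) = multiChoose (ν + μ) μ * multiFactorial μ * multiFactorial ν := by
  have h0 : (ν + μ).support ⊆ ν.support ∪ μ.support := Finsupp.support_add
  rw [multiFactorial, multiFactorial, multiFactorial, multiChoose,
    Finsupp.prod_of_support_subset _ h0 _ (by simp),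
    Finsupp.prod_of_support_subset ν Finset.subset_union_left _ (by simp),
    Finsupp.prod_of_support_subset μ Finset.subset_union_right _ (by simp),
    Finsupp.prod_of_support_subset μ Finset.subset_union_right _ (by simp),
    ← Finset.prod_mul_distrib, ← Finset.prod_mul_distrib]
  refine Finset.prod_congr rfl fun j _ => ?_
  rw [Finsupp.add_apply, mul_right_comm,
    Nat.add_choose_mul_factorial_mul_factorial]

theorem multiChoose_eq_zero {ν μ : ℕ →₀ ℕ} (h : ¬ μ ≤ ν) : multiChoose ν μ = 0 := by
  rw [Finsupp.le_def] at h
  push Not at h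
  obtain ⟨j, hj⟩ := h
  exact Finset.prod_eq_zero (Finsupp.mem_support_iff.2 (by omega)) (Nat.choose_eq_zero_of_lt hj)

theorem multiChoose_mul_rhoPow (ρ : ℕ → ℝ) (ν μ : ℕ →₀ ℕ) :
    (multiChoose ν μ : ℝ) * rhoPow ρ μ =
      μ.prod fun j m => ((ν j).choose m : ℝ) * ρ j ^ (2 * m) := by
  simp [multiChoose, rhoPow, Finsupp.prod, Finset.prod_mul_distrib]

theorem rhoPow_nonneg (ρ : ℕ → ℝ) (μ : ℕ →₀ ℕ) : 0 ≤ rhoPow ρ μ :=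
  Finset.prod_nonneg fun j _ => (even_two_mul (μ j)).pow_nonneg (ρ j)

theorem summable_hermiteWeight (r : ℕ) (ρ : ℕ → ℝ) (ν : ℕ →₀ ℕ) :
    Summable (fun μ : BoundedIndex r => (multiChoose ν μ : ℝ) * rhoPow ρ μ) := by
  refine summable_of_hasFiniteSupport (((Set.finite_Iic ν).preimage
    Subtype.val_injective.injOn).subset fun μ hμ => ?_)
  by_contra h
  exact hμ (by simp [multiChoose_eq_zero (show ¬ (μ : ℕ →₀ ℕ) ≤ ν from h)])

theorem hermiteWeight_eq_prod (r : ℕ) (ρ : ℕ → ℝ) (ν : ℕ →₀ ℕ) :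
    hermiteWeight r ρ ν =
      ∏ j ∈ ν.support, ∑ l ∈ Finset.range (r + 1), ((ν j).choose l : ℝ) * ρ j ^ (2 * l) := by
  -- The box of indices supported in the support of `ν` with entries at most `r`. An admissible
  -- index outside it is not below `ν`, so its binomial vanishes; over the box the sum factors.
  set T : Finset (ℕ →₀ ℕ) := ν.support.finsupp fun _ => Finset.range (r + 1) with hT
  have h1 : hermiteWeight r ρ ν = ∑ μ ∈ T, (multiChoose ν μ : ℝ) * rhoPow ρ μ := by
    refine (tsum_subtype {μ : ℕ →₀ ℕ | ∀ j, μ j ≤ r}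
      (fun μ => (multiChoose ν μ : ℝ) * rhoPow ρ μ)).trans ?_
    rw [tsum_eq_sum (s := T)]
    · refine Finset.sum_congr rfl fun μ hμ => Set.indicator_of_mem (fun j => ?_) _
      rw [hT, Finset.mem_finsupp_iff] at hμ
      by_cases hj : j ∈ ν.support
      · exact Nat.lt_succ_iff.1 (Finset.mem_range.1 (hμ.2 j hj))
      · rw [Finsupp.notMem_support_iff.1 fun h => hj (hμ.1 h)]; exact r.zero_le
    · intro μ hμ
      by_cases hr : μ ∈ {μ : ℕ →₀ ℕ | ∀ j, μ j ≤ r}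
      · rw [Set.indicator_of_mem hr, multiChoose_eq_zero, Nat.cast_zero, zero_mul]
        intro hle
        refine hμ (Finset.mem_finsupp_iff.2 ⟨Finsupp.support_mono hle, fun j _ => ?_⟩)
        exact Finset.mem_range.2 (Nat.lt_succ_iff.2 (hr j))
      · exact Set.indicator_of_notMem hr _
  rw [h1, Finset.prod_sum, hT, Finset.finsupp, Finset.sum_map]
  refine Finset.sum_congr (by congr!) fun p _ => ?_
  rw [multiChoose_mul_rhoPow, Function.Embedding.coeFn_mk, Finsupp.prod_of_support_subset (s := ν.support) _
    (Finsupp.support_indicator_subset _ _) _ (by simp), ← Finset.prod_attach]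
  refine Finset.prod_congr rfl fun j _ => ?_
  simp [Finsupp.indicator_of_mem j.2]

theorem hasProd_hermiteWeight (r : ℕ) (ρ : ℕ → ℝ) (ν : ℕ →₀ ℕ) :
    HasProd (fun j : ℕ => ∑ l ∈ Finset.range (r + 1), ((ν j).choose l : ℝ) * ρ j ^ (2 * l))
      (hermiteWeight r ρ ν) := by
  rw [hermiteWeight_eq_prod]
  refine hasProd_prod_of_ne_finset_one fun j hj => ?_
  rw [Finsupp.notMem_support_iff.1 hj, Finset.sum_range_succ']
  simp

/-- Exchange of the two multi-index sums. -/
theorem tsum_tsum_multiChoose (r : ℕ) (ρ : ℕ → ℝ) (g : (ℕ →₀ ℕ) → ℝ) (hg : ∀ ν, 0 ≤ g ν) :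
    ∑' μ : BoundedIndex r, ∑' ν : ℕ →₀ ℕ,
        ENNReal.ofReal (multiChoose (ν + μ) μ * rhoPow ρ μ * g (ν + μ)) =
      ∑' ν : ℕ →₀ ℕ, ENNReal.ofReal (hermiteWeight r ρ ν * g ν) := by
  have h1 : ∀ μ : ℕ →₀ ℕ, ∑' ν : ℕ →₀ ℕ,
      ENNReal.ofReal (multiChoose (ν + μ) μ * rhoPow ρ μ * g (ν + μ)) =
        ∑' ν : ℕ →₀ ℕ, ENNReal.ofReal (multiChoose ν μ * rhoPow ρ μ * g ν) := fun μ => by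
    -- The shift by `μ` is injective and its range contains every `ν` with a nonzero term, as `C(ν,
    -- μ) = 0` unless `μ ≤ ν`.
    refine (add_left_injective μ).tsum_eq
      (f := fun ν => ENNReal.ofReal (multiChoose ν μ * rhoPow ρ μ * g ν)) fun ν hν => ?_
    have hle : μ ≤ ν := by
      by_contra h
      exact hν (by simp [multiChoose_eq_zero h])
    exact ⟨ν - μ, tsub_add_cancel_of_le hle⟩
  simp only [h1]
  rw [ENNReal.tsum_comm]
  refine tsum_congr fun ν => ?_
  rw [hermiteWeight, ← tsum_mul_right, ENNReal.ofReal_tsum_of_nonneg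
    (fun μ => mul_nonneg (mul_nonneg (Nat.cast_nonneg _) (rhoPow_nonneg ρ _)) (hg ν))
    ((summable_hermiteWeight r ρ ν).mul_right _)]

/-! ### The lognormal problem -/

section Lognormal

variable {d : ℕ} {D : Set (Pt d)}

/-- The gradient as a bounded operator on `H¹₀(D)`. -/
noncomputable def gradL (D : Set (Pt d)) : HOneZero D →L[ℝ] Lp (Pt d) 2 (vol D) :=
  (WithLp.sndL 2 ℝ (Lp ℝ 2 (vol D)) (Lp (Pt d) 2 (vol D))).comp
    (testPairs D).topologicalClosure.subtypeL

/-- The Riesz representative of a functional on `H¹₀(D)`. -/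
noncomputable def riesz (f : HOneZero D →L[ℝ] ℝ) : HOneZero D :=
  (InnerProductSpace.toDual ℝ (HOneZero D)).symm f

theorem inner_riesz (f : HOneZero D →L[ℝ] ℝ) (w : HOneZero D) : inner ℝ (riesz f) w = f w :=
  InnerProductSpace.toDual_symm_apply

/-- The solution as a function of the field in `L^∞`. -/
noncomputable def solMap (f : HOneZero D →L[ℝ] ℝ) (B : Lp ℝ ∞ (vol D)) : HOneZero D :=
  solOp (gradL D) expOp B (riesz f)

theorem exists_gradL_coercive (hd : 0 < d) (hDb : Bornology.IsBounded D) :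
    ∃ K > 0, ∀ v : HOneZero D, ‖v‖ ^ 2 ≤ K * ‖gradL D v‖ ^ 2 :=
  exists_norm_sq_le_gradNorm hd hDb

theorem isWeakSolution_iff (hd : 0 < d) (hDb : Bornology.IsBounded D)
    (f : HOneZero D →L[ℝ] ℝ) (B : Lp ℝ ∞ (vol D)) (v : HOneZero D) :
    IsWeakSolution (fun x => Real.exp (B x)) f v ↔ v = solMap f B := by
  obtain ⟨K, hK, hG⟩ := exists_gradL_coercive hd hDb
  have h1 : ∀ w : HOneZero D, ∫ x in D, Real.exp (B x) * inner ℝ (v.grad x) (w.grad x) =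
      inner ℝ (sandwich (gradL D) (expOp B) v) w := fun w => by
    rw [inner_sandwich, L2.inner_def]
    refine integral_congr_ae ?_
    filter_upwards [coeFn_expOp B (gradL D v)] with x hx
    rw [hx, real_inner_smul_left]; rfl
  have h2 : IsWeakSolution (fun x => Real.exp (B x)) f v ↔
      sandwich (gradL D) (expOp B) v = riesz f := by
    simp only [IsWeakSolution, h1, ← inner_riesz f]
    exact ⟨fun h => ext_inner_right ℝ h, fun h w => by rw [h]⟩
  rw [h2]
  refine ⟨fun h => ?_, fun h => ?_⟩
  · rw [solMap, ← h, solOp_sandwich isExpFamily_expOp hK hG]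
  · rw [h, solMap, sandwich_solOp isExpFamily_expOp hK hG]

theorem solution_eq_solMap (hd : 0 < d) (hDb : Bornology.IsBounded D)
    (ψ : ℕ → Lp ℝ ∞ (vol D)) (f : HOneZero D →L[ℝ] ℝ) (y : ℕ → ℝ) :
    solution ψ f y = solMap f (field ψ y) := by
  have hi := isWeakSolution_iff hd hDb f (field ψ y)
  have h : ∃ v, IsWeakSolution (coeff ψ y) f v := ⟨_, (hi _).2 rfl⟩
  rw [solution, dif_pos h]
  exact (hi _).1 h.choose_spec

/-- The set of parameters at which the series for the field converges. -/
def convSet (ψ : ℕ → Lp ℝ ∞ (vol D)) : Set (ℕ → ℝ) := {y | ∃ B, IsFieldSum ψ y B}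

theorem isFieldSum_field {ψ : ℕ → Lp ℝ ∞ (vol D)} {y : ℕ → ℝ} (hy : y ∈ convSet ψ) :
    IsFieldSum ψ y (field ψ y) := by
  have h : ∃ B, IsFieldSum ψ y B := hy
  rw [field, dif_pos h]
  exact h.choose_spec

/-- All partial sums past index `j` change by exactly `t • ψ j`. Whole coordinate lines therefore
stay in the convergence set, so almost every `y` allows derivatives at every point of its line. -/
theorem isFieldSum_add_single {ψ : ℕ → Lp ℝ ∞ (vol D)} {y : ℕ → ℝ} {B : Lp ℝ ∞ (vol D)}
    (h : IsFieldSum ψ y B) (t : ℝ) (j : ℕ) :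
    IsFieldSum ψ (y + t • Pi.single j 1) (B + t • ψ j) := by
  refine Tendsto.congr' ?_ (Tendsto.add_const (t • ψ j) h)
  filter_upwards [eventually_gt_atTop j] with J hJ
  have : ∑ i ∈ Finset.range J, (t • Pi.single j 1 : ℕ → ℝ) i • ψ i = t • ψ j := by
    rw [Finset.sum_eq_single_of_mem j (Finset.mem_range.2 hJ)]
    · simp
    · intro i _ hij; simp [hij]
  rw [← this, ← Finset.sum_add_distrib]
  exact Finset.sum_congr rfl fun i _ => by rw [← add_smul]; rfl

theorem add_single_mem_convSet {ψ : ℕ → Lp ℝ ∞ (vol D)} {y : ℕ → ℝ} (hy : y ∈ convSet ψ)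
    (t : ℝ) (j : ℕ) : y + t • Pi.single j 1 ∈ convSet ψ :=
  ⟨_, isFieldSum_add_single (isFieldSum_field hy) t j⟩

theorem field_add_single {ψ : ℕ → Lp ℝ ∞ (vol D)} {y : ℕ → ℝ} (hy : y ∈ convSet ψ)
    (t : ℝ) (j : ℕ) : field ψ (y + t • Pi.single j 1) = field ψ y + t • ψ j :=
  tendsto_nhds_unique (isFieldSum_field (add_single_mem_convSet hy t j))
    (isFieldSum_add_single (isFieldSum_field hy) t j)

theorem update_eq_add_single (y : ℕ → ℝ) (j : ℕ) (s t : ℝ) :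
    Function.update y j s = Function.update y j t + (s - t) • Pi.single j 1 := by
  ext i
  by_cases h : i = j
  · subst h; simp
  · simp [h]

theorem update_mem_convSet {ψ : ℕ → Lp ℝ ∞ (vol D)} {y : ℕ → ℝ} (hy : y ∈ convSet ψ)
    (j : ℕ) (t : ℝ) : Function.update y j t ∈ convSet ψ := by
  have h := update_eq_add_single y j t (y j)
  rw [Function.update_eq_self] at h
  rw [h]
  exact add_single_mem_convSet hy _ j

/-- The class generated by the solution map of the lognormal problem. -/
abbrev LognormalClass (f : HOneZero D →L[ℝ] ℝ) : (Lp ℝ ∞ (vol D) → HOneZero D) → Prop :=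
  SolutionClass (gradL D) expOp (riesz f)

theorem hasLineDerivAt_of_eqOn {ψ : ℕ → Lp ℝ ∞ (vol D)} {w : (ℕ → ℝ) → HOneZero D}
    {F F' : Lp ℝ ∞ (vol D) → HOneZero D} {j : ℕ}
    (hw : ∀ y ∈ convSet ψ, w y = F (field ψ y))
    (hF : ∀ B, HasDerivAt (fun t : ℝ => F (B + t • ψ j)) (F' B) 0)
    {y : ℕ → ℝ} (hy : y ∈ convSet ψ) :
    HasLineDerivAt ℝ w (F' (field ψ y)) y (Pi.single j 1) := by
  have e : (fun t : ℝ => w (y + t • Pi.single j 1)) = fun t => F (field ψ y + t • ψ j) := by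
    ext1 t
    rw [hw _ (add_single_mem_convSet hy t j), field_add_single hy]
  unfold HasLineDerivAt
  rw [e]
  exact hF _

theorem exists_listDeriv_eq (hd : 0 < d) (hDb : Bornology.IsBounded D)
    (ψ : ℕ → Lp ℝ ∞ (vol D)) (f : HOneZero D →L[ℝ] ℝ) (l : List ℕ) :
    ∃ F, LognormalClass f F ∧
      ∀ y ∈ convSet ψ, listDeriv l (solution ψ f) y = F (field ψ y) := by
  obtain ⟨K, hK, hG⟩ := exists_gradL_coercive hd hDb
  induction l with
  | nil => exact ⟨_, SolutionClass.base, fun y _ => solution_eq_solMap hd hDb ψ f y⟩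
  | cons j l ih =>
    obtain ⟨F, hF, he⟩ := ih
    obtain ⟨F', hF', hd'⟩ := hF.exists_hasDerivAt isExpFamily_expOp hK hG (ψ j)
    exact ⟨F', hF', fun y hy => (hasLineDerivAt_of_eqOn he hd' hy).lineDeriv⟩

theorem hasLineDerivAt_listDeriv (hd : 0 < d) (hDb : Bornology.IsBounded D)
    (ψ : ℕ → Lp ℝ ∞ (vol D)) (f : HOneZero D →L[ℝ] ℝ) (l : List ℕ) (j : ℕ)
    {y : ℕ → ℝ} (hy : y ∈ convSet ψ) :
    HasLineDerivAt ℝ (listDeriv l (solution ψ f)) (listDeriv (j :: l) (solution ψ f) y) y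
      (Pi.single j 1) := by
  obtain ⟨K, hK, hG⟩ := exists_gradL_coercive hd hDb
  obtain ⟨F, hF, he⟩ := exists_listDeriv_eq hd hDb ψ f l
  obtain ⟨F', hF', hd'⟩ := hF.exists_hasDerivAt isExpFamily_expOp hK hG (ψ j)
  exact (hasLineDerivAt_of_eqOn he hd' hy).lineDifferentiableAt.hasLineDerivAt

theorem hasDerivAt_listDeriv_update (hd : 0 < d) (hDb : Bornology.IsBounded D)
    (ψ : ℕ → Lp ℝ ∞ (vol D)) (f : HOneZero D →L[ℝ] ℝ) (l : List ℕ) (j : ℕ)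
    {y : ℕ → ℝ} (hy : y ∈ convSet ψ) (t : ℝ) :
    HasDerivAt (fun s => listDeriv l (solution ψ f) (Function.update y j s))
      (listDeriv (j :: l) (solution ψ f) (Function.update y j t)) t := by
  have h := hasLineDerivAt_listDeriv hd hDb ψ f l j (update_mem_convSet hy j t)
  have e : (fun s => listDeriv l (solution ψ f) (Function.update y j s)) = fun s =>
      listDeriv l (solution ψ f) (Function.update y j t + (s - t) • Pi.single j 1) := by
    ext1 s; rw [update_eq_add_single y j s t]
  rw [e]
  refine HasDerivAt.comp_sub_const (f := fun s => listDeriv l (solution ψ f)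
    (Function.update y j t + s • Pi.single j 1)) t t ?_
  simpa using! h

/-! ### Square integrability, Hermite coefficients and energies of the derivatives. -/

variable {ψ : ℕ → Lp ℝ ∞ (vol D)}

theorem memLp_exp_norm_field (hM : ∀ k : ℝ, 0 ≤ k → PropertyM ψ k) {k : ℝ} (hk : 0 ≤ k) :
    MemLp (fun y => Real.exp (k * ‖field ψ y‖)) 2 gammaU := by
  have hm : AEStronglyMeasurable (fun y => Real.exp (k * ‖field ψ y‖)) gammaU :=
    (hM k hk).2.2.aestronglyMeasurable
  rw [memLp_two_iff_integrable_sq hm]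
  refine (hM (2 * k) (by positivity)).2.2.congr (ae_of_all _ fun y => ?_)
  simp only
  rw [sq, ← Real.exp_add]; ring_nf

theorem memLp_listDeriv (hd : 0 < d) (hDb : Bornology.IsBounded D)
    (hM : ∀ k : ℝ, 0 ≤ k → PropertyM ψ k) (f : HOneZero D →L[ℝ] ℝ) (l : List ℕ) :
    MemLp (listDeriv l (solution ψ f)) 2 gammaU := by
  obtain ⟨K, hK, hG⟩ := exists_gradL_coercive hd hDb
  obtain ⟨F, hF, he⟩ := exists_listDeriv_eq hd hDb ψ f l
  obtain ⟨C, k, hC, hk, hb⟩ := hF.exists_norm_le isExpFamily_expOp hK hG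
  have hFm : MemLp (fun y => F (field ψ y)) 2 gammaU := by
    refine ((memLp_exp_norm_field hM hk).const_mul C).mono
      ((hF.continuous isExpFamily_expOp hK hG).comp_aestronglyMeasurable (hM 0 le_rfl).2.1)
      (ae_of_all _ fun y => (hb _).trans (le_abs_self _))
  refine hFm.ae_eq ?_
  filter_upwards [(hM 0 le_rfl).1] with y hy
  exact (he y hy).symm

/-- The normalization by `√(ν!)` absorbs the factor `√(ν_j + 1)` of each shift, so the induction
telescopes. The right side sees only the multiset of the list, not its order. -/
theorem sqrt_smul_hermiteCoeff_listDeriv (hd : 0 < d) (hDb : Bornology.IsBounded D)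
    (hM : ∀ k : ℝ, 0 ≤ k → PropertyM ψ k) (f : HOneZero D →L[ℝ] ℝ) (l : List ℕ) (ν : ℕ →₀ ℕ) :
    √(multiFactorial ν : ℝ) • hermiteCoeff (listDeriv l (solution ψ f)) ν =
      √(multiFactorial (ν + Multiset.toFinsupp (l : Multiset ℕ)) : ℝ) •
        hermiteCoeff (solution ψ f) (ν + Multiset.toFinsupp (l : Multiset ℕ)) := by
  induction l generalizing ν with
  | nil => simp [listDeriv]
  | cons j l ih =>
    have h := hermiteCoeff_deriv (w := listDeriv l (solution ψ f))
      (w' := listDeriv (j :: l) (solution ψ f)) j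
      (by
        filter_upwards [(hM 0 le_rfl).1] with y hy
        exact hasDerivAt_listDeriv_update hd hDb ψ f l j hy)
      (memLp_listDeriv hd hDb hM f l) (memLp_listDeriv hd hDb hM f (j :: l)) ν
    have e : ν + Multiset.toFinsupp ((j :: l : List ℕ) : Multiset ℕ) =
        ν + Finsupp.single j 1 + Multiset.toFinsupp (l : Multiset ℕ) := by
      rw [← Multiset.cons_coe, ← Multiset.singleton_add, Multiset.toFinsupp_add,
        Multiset.toFinsupp_singleton, add_assoc]
    rw [h, e, ← ih, smul_smul, multiFactorial_add_single, mul_comm, Nat.cast_mul,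
      Real.sqrt_mul (by positivity)]
    push_cast; rfl

theorem gradNorm_smul (c : ℝ) (v : HOneZero D) : (c • v).gradNorm = |c| * v.gradNorm := by
  have : (c • v).grad = c • v.grad := (gradL D).map_smul c v
  rw [HOneZero.gradNorm, this, norm_smul]; rfl

theorem gradNorm_sq_hermiteCoeff_multiDeriv (hd : 0 < d) (hDb : Bornology.IsBounded D)
    (hM : ∀ k : ℝ, 0 ≤ k → PropertyM ψ k) (f : HOneZero D →L[ℝ] ℝ) (μ ν : ℕ →₀ ℕ) :
    (hermiteCoeff (multiDeriv μ (solution ψ f)) ν).gradNorm ^ 2 =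
      multiChoose (ν + μ) μ * multiFactorial μ *
        (hermiteCoeff (solution ψ f) (ν + μ)).gradNorm ^ 2 := by
  have h := sqrt_smul_hermiteCoeff_listDeriv hd hDb hM f
    ((Finsupp.toMultiset μ).sort (· ≤ ·)) ν
  rw [Multiset.sort_eq, Finsupp.toMultiset_toFinsupp] at h
  have h2 := congrArg (fun v : HOneZero D => v.gradNorm ^ 2) h
  simp only [gradNorm_smul, mul_pow, sq_abs] at h2
  rw [Real.sq_sqrt (by positivity), Real.sq_sqrt (by positivity), multiFactorial_add] at h2
  have hp : (multiFactorial ν : ℝ) ≠ 0 := by exact_mod_cast (multiFactorial_pos ν).ne'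
  refine mul_left_cancel₀ hp (h2.trans ?_)
  push_cast; ring

/-- Parseval is applied to `∇w` in `L²(D; ℝ^d)`, since the inherited norm of `V` is the full `H¹`
norm; the gradient commutes with taking coefficients. -/
theorem lintegral_gradNorm_sq {w : (ℕ → ℝ) → HOneZero D} (hw : MemLp w 2 gammaU) :
    ∫⁻ y, ENNReal.ofReal ((w y).gradNorm ^ 2) ∂gammaU =
      ∑' ν, ENNReal.ofReal ((hermiteCoeff w ν).gradNorm ^ 2) := by
  have hG : MemLp (fun y => gradL D (w y)) 2 gammaU := (gradL D).comp_memLp' hw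
  -- Needed for the separability of `L²`.
  have : Fact ((2 : ℝ≥0∞) ≠ ⊤) := ⟨by simp⟩
  have h := lintegral_norm_sq_eq_tsum_hermiteCoeff hG
  simp only [hermiteCoeff_clm (gradL D) hw] at h
  exact h

end Lognormal

theorem theorem3p2 {d : ℕ} (hd : 0 < d) (D : Set (Pt d)) (hDo : IsOpen D)
    (hDb : Bornology.IsBounded D)
    (ψ : ℕ → Lp ℝ ∞ (vol D)) (f : HOneZero D →L[ℝ] ℝ)
    (hM : ∀ k : ℝ, 0 ≤ k → PropertyM ψ k)
    (r : ℕ) (ρ : ℕ → ℝ) (hρ : ∀ j, 0 < ρ j) :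
    -- almost surely `u(y)` is the unique weak solution and all its partial derivatives exist in `V`
    (∀ᵐ y ∂gammaU, (∀ v, IsWeakSolution (coeff ψ y) f v ↔ v = solution ψ f y) ∧
      ∀ (l : List ℕ) (j : ℕ),
        LineDifferentiableAt ℝ (listDeriv l (solution ψ f)) y (Pi.single j 1)) ∧
    -- the integrals in the identity and the Hermite coefficients are well defined and finite
    (∀ μ : ℕ →₀ ℕ, MemLp (multiDeriv μ (solution ψ f)) 2 gammaU) ∧
    (∀ ν : ℕ →₀ ℕ, Integrable (fun y => multiHermite ν y • solution ψ f y) gammaU) ∧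
    -- the identity, both sides in `[0, ∞]`
    (∑' μ : BoundedIndex r, ENNReal.ofReal (rhoPow ρ μ / multiFactorial μ) *
        ∫⁻ y, ENNReal.ofReal ((multiDeriv μ (solution ψ f) y).gradNorm ^ 2) ∂gammaU =
      ∑' ν : ℕ →₀ ℕ,
        ENNReal.ofReal (hermiteWeight r ρ ν * (hermiteCoeff (solution ψ f) ν).gradNorm ^ 2)) ∧
    -- the sum that defines `b_ν` converges, and `b_ν` has the product form
    (∀ ν : ℕ →₀ ℕ,
      Summable (fun μ : BoundedIndex r => (multiChoose ν μ : ℝ) * rhoPow ρ μ) ∧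
      HasProd (fun j : ℕ => ∑ l ∈ Finset.range (r + 1), ((ν j).choose l : ℝ) * ρ j ^ (2 * l))
        (hermiteWeight r ρ ν)) := by
  refine ⟨?_, fun μ => memLp_listDeriv hd hDb hM f _, fun ν =>
    integrable_multiHermite_smul ν (memLp_listDeriv hd hDb hM f []), ?_,
    fun ν => ⟨summable_hermiteWeight r ρ ν, hasProd_hermiteWeight r ρ ν⟩⟩
  · filter_upwards [(hM 0 le_rfl).1] with y hy
    refine ⟨fun v => ?_, fun l j =>
      (hasLineDerivAt_listDeriv hd hDb ψ f l j hy).lineDifferentiableAt⟩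
    rw [solution_eq_solMap hd hDb]
    exact isWeakSolution_iff hd hDb f (field ψ y) v
  -- With the right side unfolded into a double sum, the identity holds term by term in `μ` and `ν`:
  -- the factor `μ!` from the coefficients cancels the one in the weight.
  · rw [← tsum_tsum_multiChoose r ρ
      (fun ν => (hermiteCoeff (solution ψ f) ν).gradNorm ^ 2) fun ν => sq_nonneg _]
    refine tsum_congr fun μ => ?_
    rw [lintegral_gradNorm_sq (w := multiDeriv μ (solution ψ f)) (memLp_listDeriv hd hDb hM f _),
      ← ENNReal.tsum_mul_left]
    refine tsum_congr fun ν => ?_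
    have hp : (0 : ℝ) < multiFactorial (μ : ℕ →₀ ℕ) := by exact_mod_cast multiFactorial_pos _
    rw [← ENNReal.ofReal_mul (div_nonneg (rhoPow_nonneg ρ _) hp.le),
      gradNorm_sq_hermiteCoeff_multiDeriv hd hDb hM]
    congr 1
    field_simp
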